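/- Let $(a;q)_n=\prod_{k=0}^{n-1}(1-aq^k)$, $(q)_n=(q;q)_n$, $1/(q)_n=0$ for $n<0$, $(a_1,\dots,a_k;q)_\infty=\prod_i(a_i;q)_\infty$; let ${N\brack k}_q=\frac{(q)_N}{(q)_k(q)_{N-k}}$ for $0\le k\le N$ and $0$ otherwise, and let $\left(\frac{j}{3}\right)$ be the Legendre symbol modulo $3$. Let $v\ge 1$ be an integer, and for $n_1,\dots,n_v\ge 0$ put $N_i=n_i+n_{i+1}+\cdots+n_v$. (1) For every integer $L\ge 0$, as an identity in the variable $q$ (that is, for $q$ in any field of characteristic $0$ with $q^m\neq 1$ for all $m\ge1$; in particular for an indeterminate $q$), $$\frac{1-q^3}{1-q}\sum_{n_1,\ldots,n_v\geq 0} \frac{q^{\sum_{i=1}^v (N_i+2)N_i+n_v}(1-q^{1+n_v})}{(q)_{n_1}\cdots(q)_{n_{v-1}}(q)_{2n_v+2}}\,\frac{(-1;q^3)_{n_v}}{(-1;q)_{n_v}}\,\frac{(q)_{2L}}{(q)_{L-1-N_1}}=\sum_{j=-\infty}^\infty \left(\frac{j}{3}\right) q^{\frac{(2v+1)j^2-3j}{2}-(v-1)}{2L\brack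 L+j}_q,$$ where both sums have only finitely many nonzero terms. (2) Let $q\in\mathbb{C}$ with $|q|<1$. Multiplied by $\frac{1-q}{1-q^3}$, the right-hand side of the identity in (1) converges, as $L\to\infty$, to the product on the right below; the two series below converge absolutely, and $$\sum_{n_1,\ldots,n_v\geq 0} \frac{q^{\sum_{i=1}^v (N_i+2)N_i+n_v}(1-q^{1+n_v})}{(q)_{n_1}\cdots(q)_{n_{v-1}}(q)_{2n_v+2}}\,\frac{(-1;q^3)_{n_v}}{(-1;q)_{n_v}}=\frac{1-q}{1-q^3}\sum_{j=-\infty}^\infty\frac{\left(\frac{j}{3}\right) q^{\frac{(2v+1)j^2-3j}{2}+1-v}}{(q)_\infty}=\frac{(q^{6v+3},q^{3v},q^{3v+3};q^{6v+3})_\infty\,(q^{12v+3},q^{12v+9};q^{12v+6})_\infty}{(q^2;q)_\infty}.$$ -/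

import Mathlib

open Filter Topology

noncomputable section

/-- The finite `q`-Pochhammer symbol `(a;q)_n = (1-a)(1-aq)⋯(1-aq^{n-1})`. -/
def qPoch {K : Type*} [Field K] (a q : K) (n : ℕ) : K :=
  ∏ k ∈ Finset.range n, (1 - a * q ^ k)

/-- The reciprocal `1/(q;q)_m` for an integer `m`, equal to `0` for negative `m`. -/
def qPochRecip {K : Type*} [Field K] (q : K) (m : ℤ) : K :=
  if 0 ≤ m then (qPoch q q m.toNat)⁻¹ else 0

/-- The `q`-binomial coefficient `[N; k]_q = (q;q)_N / ((q;q)_k (q;q)_{N-k})` for `0 ≤ k ≤ N`,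
and `0` otherwise. -/
def qBinom {K : Type*} [Field K] (q : K) (N k : ℤ) : K :=
  if 0 ≤ k ∧ k ≤ N then
    qPoch q q N.toNat / (qPoch q q k.toNat * qPoch q q (N - k).toNat)
  else 0

/-- The infinite `q`-Pochhammer symbol `(a;q)_∞`, for `|q| < 1`. -/
def qPochInf (a q : ℂ) : ℂ :=
  ∏' k : ℕ, (1 - a * q ^ k)

/-- For `|q| < 1`, `(a;q)_∞` is the limit of `(a;q)_n`. -/
theorem tendsto_qPoch (a q : ℂ) (hq : ‖q‖ < 1) :
    Tendsto (fun n : ℕ => qPoch a q n) atTop (𝓝 (qPochInf a q)) := by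
  have hs : Summable fun k : ℕ => ‖-(a * q ^ k)‖ := by
    have := (summable_geometric_of_lt_one (norm_nonneg q) hq).mul_left ‖a‖
    simpa [norm_mul, norm_pow] using this
  have hm : Multipliable fun k : ℕ => (1 - a * q ^ k) := by
    simpa [sub_eq_add_neg] using multipliable_one_add_of_summable hs
  exact hm.hasProd.tendsto_prod_nat

/-- The first index of `n = (n_1, …, n_v)`, where `v ≥ 1`. -/
def firstIdx (v : ℕ) (hv : 1 ≤ v) : Fin v := ⟨0, by omega⟩

/-- The last index of `n = (n_1, …, n_v)`, where `v ≥ 1`. -/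
def lastIdx (v : ℕ) (hv : 1 ≤ v) : Fin v := ⟨v - 1, by omega⟩

/-- The tail sum `N_i = n_i + n_{i+1} + ⋯ + n_v`. -/
def tailSum {v : ℕ} (n : Fin v → ℕ) (i : Fin v) : ℕ :=
  ∑ k ∈ Finset.Ici i, n k

/-- The `L`-independent summand
`q^{∑ (N_i+2)N_i + n_v} (1 - q^{1+n_v}) / ((q)_{n_1} ⋯ (q)_{n_{v-1}} (q)_{2n_v+2})
  · (-1;q³)_{n_v} / (-1;q)_{n_v}`. -/
def multisumTerm {K : Type*} [Field K] (q : K) (v : ℕ) (hv : 1 ≤ v) (n : Fin v → ℕ) : K :=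
  q ^ ((∑ i : Fin v, (tailSum n i + 2) * tailSum n i) + n (lastIdx v hv))
      * (1 - q ^ (1 + n (lastIdx v hv)))
    / ((∏ i ∈ Finset.univ.erase (lastIdx v hv), qPoch q q (n i))
        * qPoch q q (2 * n (lastIdx v hv) + 2))
    * (qPoch (-1) (q ^ 3) (n (lastIdx v hv)) / qPoch (-1) q (n (lastIdx v hv)))

/-- The summand of the finite multisum: the previous one times `(q)_{2L} / (q)_{L-1-N_1}`. -/
def finiteMultisumTerm {K : Type*} [Field K] (q : K) (v : ℕ) (hv : 1 ≤ v) (L : ℕ)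
    (n : Fin v → ℕ) : K :=
  multisumTerm q v hv n
    * (qPoch q q (2 * L) * qPochRecip q ((L : ℤ) - 1 - tailSum n (firstIdx v hv)))

/-- The term `(j/3) q^{((2v+1)j² - 3j)/2 - (v-1)}`. The numerator `(2v+1)j² - 3j` is even, and the
exponent is nonnegative whenever `(j/3) ≠ 0`. -/
def legendreTerm {K : Type*} [Field K] (q : K) (v : ℕ) (j : ℤ) : K :=
  (legendreSym 3 j : K) * q ^ (((2 * (v : ℤ) + 1) * j ^ 2 - 3 * j) / 2 - ((v : ℤ) - 1))

/-- The product
`(q^{6v+3}, q^{3v}, q^{3v+3}; q^{6v+3})_∞ (q^{12v+3}, q^{12v+9}; q^{12v+6})_∞ / (q²;q)_∞`. -/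
def productSide (q : ℂ) (v : ℕ) : ℂ :=
  qPochInf (q ^ (6 * v + 3)) (q ^ (6 * v + 3))
    * qPochInf (q ^ (3 * v)) (q ^ (6 * v + 3))
    * qPochInf (q ^ (3 * v + 3)) (q ^ (6 * v + 3))
    * (qPochInf (q ^ (12 * v + 3)) (q ^ (12 * v + 6))
      * qPochInf (q ^ (12 * v + 9)) (q ^ (12 * v + 6)))
    / qPochInf (q ^ 2) q

end

/-! The finite identity is a Bailey chain. Divided by (q)_{2L}, its right side is S_v(L) = Σ_j
a_v(j)/((q)_{L+j}(q)_{L-j}) with a_v(j) = (j/3) q^{(j-1)(j-2)/2 + v(j²-1)}, so raising v by one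
multiplies a_v(j) by q^{j²-1}. By q-Chu–Vandermonde the same factor arises from summing over N
against q^{N(N+2)}/(q)_{L-1-N} (`sum_pow_mul_recip_mul_recip`), which expresses S_{v+1}(L) through
the S_v(N+1) (`bilateralSum_succ`). The multisum, sliced by N_1 = N, obeys the same recurrence
(`boxSum_succ`), so only the seed S_0 remains.

For the seed, (j/3) is proportional to ω^j - ω^{-j} with ω a primitive cube root of unity, so S_0 is
a difference of two finite Jacobi triple products. There (1+ωx)(x+ω) = ω(1-x+x²), and 1-x+x² =
(1+x³)/(1+x) accounts for (-1;q³)_n/(-1;q)_n.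

For (2), let L → ∞ by dominated convergence. In the bilateral series the terms with 3 ∣ j vanish,
and the classes 1 and 2 pair up into a quintuple product series with base q^{6v+3} and z = -q^{3v}.
The quintuple product is in turn the limit of a terminating sum (`finite_quintuple_product`). The
case q = 0 is separate. -/

noncomputable section

/-! ### Finite q-series: Pascal rules, Chu–Vandermonde, triple product. -/

section Finite

variable {K : Type*} [Field K] {q : K}

theorem qPoch_zero (a q : K) : qPoch a q 0 = 1 := by simp [qPoch]

theorem qPoch_succ (a q : K) (n : ℕ) : qPoch a q (n + 1) = qPoch a q n * (1 - a * q ^ n) := by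
  simp [qPoch, Finset.prod_range_succ]

theorem qPoch_succ' (a q : K) (n : ℕ) : qPoch a q (n + 1) = (1 - a) * qPoch (a * q) q n := by
  simp only [qPoch, Finset.prod_range_succ', pow_zero, mul_one]
  rw [mul_comm]
  congr 1
  exact Finset.prod_congr rfl fun k _ => by ring

theorem qPoch_self_succ (q : K) (n : ℕ) :
    qPoch q q (n + 1) = qPoch q q n * (1 - q ^ (n + 1)) := by
  rw [qPoch_succ, pow_succ']

theorem one_sub_pow_succ_ne_zero (hq : ∀ m : ℕ, 1 ≤ m → q ^ m ≠ 1) (n : ℕ) :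
    1 - q ^ (n + 1) ≠ 0 :=
  sub_ne_zero.2 (hq (n + 1) (by omega)).symm

theorem qPoch_self_ne_zero (hq : ∀ m : ℕ, 1 ≤ m → q ^ m ≠ 1) (n : ℕ) : qPoch q q n ≠ 0 := by
  refine Finset.prod_ne_zero_iff.2 fun k _ => ?_
  rw [← pow_succ']
  exact one_sub_pow_succ_ne_zero hq k

theorem qPochRecip_natCast (q : K) (n : ℕ) : qPochRecip q (n : ℤ) = (qPoch q q n)⁻¹ := by
  simp [qPochRecip]

theorem qPochRecip_of_neg (q : K) {m : ℤ} (hm : m < 0) : qPochRecip q m = 0 := by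
  simp [qPochRecip, hm]

theorem qPochRecip_zero (q : K) : qPochRecip q 0 = 1 := by
  simp [qPochRecip, qPoch_zero]

theorem qPochRecip_eq_succ (hq : ∀ m : ℕ, 1 ≤ m → q ^ m ≠ 1) (n : ℕ) :
    qPochRecip q n = (1 - q ^ (n + 1)) * qPochRecip q (n + 1) := by
  have h := one_sub_pow_succ_ne_zero hq n
  have h' := qPoch_self_ne_zero hq n
  rw [qPochRecip_natCast, show ((n : ℤ) + 1) = ((n + 1 : ℕ) : ℤ) by push_cast; ring,
    qPochRecip_natCast, qPoch_self_succ]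
  field_simp

/-- The convention 1/(q)_m = 0 for m < 0 absorbs the range condition, which spares later case
splits. -/
theorem qBinom_eq_recip (q : K) (N : ℕ) (k : ℤ) :
    qBinom q N k = qPoch q q N * (qPochRecip q k * qPochRecip q (N - k)) := by
  unfold qBinom qPochRecip
  by_cases h1 : 0 ≤ k
  · by_cases h2 : k ≤ N
    · simp [h1, h2, div_eq_mul_inv, mul_comm]
    · simp [h2]
  · simp [h1]

theorem qBinom_natCast_zero (hq : ∀ m : ℕ, 1 ≤ m → q ^ m ≠ 1) (N : ℕ) : qBinom q N 0 = 1 := by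
  have h := qPoch_self_ne_zero hq N
  rw [qBinom_eq_recip, qPochRecip_zero, sub_zero, qPochRecip_natCast, one_mul, mul_inv_cancel₀ h]

theorem qBinom_of_lt (q : K) {N k : ℤ} (h : N < k) : qBinom q N k = 0 := by
  simp [qBinom, h]

/-- The two `q`-Pascal rules have a common source: both sides of each are multiples of
`(q)_N / ((q)_{k+1} (q)_{N-k})`. -/
theorem qBinom_common (hq : ∀ m : ℕ, 1 ≤ m → q ^ m ≠ 1) {N k : ℕ} (hk : k ≤ N) :
    ∃ c : K, qBinom q N k = (1 - q ^ (k + 1)) * c ∧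
      qBinom q N (k + 1 : ℕ) = (1 - q ^ (N - k)) * c ∧
      qBinom q (N + 1 : ℕ) (k + 1 : ℕ) = (1 - q ^ (N + 1)) * c := by
  obtain ⟨d, rfl⟩ := Nat.exists_eq_add_of_le hk
  refine ⟨qPoch q q (k + d) * (qPochRecip q (k + 1) * qPochRecip q d), ?_, ?_, ?_⟩
  · rw [qBinom_eq_recip, qPochRecip_eq_succ hq k]
    push_cast
    rw [add_sub_cancel_left]
    ring
  · rw [qBinom_eq_recip]
    rcases d with _ | d
    -- For k = N both sides vanish: 1/(q)_{-1} on the left, 1 - q^0 on the right.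
    · rw [qPochRecip_of_neg q (m := ((k + 0 : ℕ) : ℤ) - (k + 1 : ℕ)) (by push_cast; omega)]
      simp
    · rw [show (((k + (d + 1) : ℕ) : ℤ) - (k + 1 : ℕ)) = d by push_cast; ring,
        qPochRecip_eq_succ hq d, Nat.add_sub_cancel_left]
      push_cast
      ring
  · rw [qBinom_eq_recip, qPoch_self_succ,
      show (((k + d + 1 : ℕ) : ℤ) - (k + 1 : ℕ)) = d by push_cast; ring]
    push_cast
    ring

/-- Pascal's rule [N+1;k+1] = [N;k+1] + q^{N-k}[N;k] summed against an arbitrary weight, so that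
inductions on N reduce to comparing weights. -/
theorem sum_qBinom_succ_left (hq : ∀ m : ℕ, 1 ≤ m → q ^ m ≠ 1) (N : ℕ) (f : ℕ → K) :
    ∑ k ∈ Finset.range (N + 2), qBinom q (N + 1 : ℕ) k * f k
      = ∑ k ∈ Finset.range (N + 1), qBinom q N k * (f k + q ^ (N - k) * f (k + 1)) := by
  have h1 : ∑ k ∈ Finset.range (N + 1), qBinom q N k * f k
      = ∑ k ∈ Finset.range (N + 1), qBinom q N (k + 1 : ℕ) * f (k + 1) + f 0 := by
    have := Finset.sum_range_succ' (fun k : ℕ => qBinom q N k * f k) (N + 1)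
    rw [Finset.sum_range_succ, qBinom_of_lt q (by push_cast; omega)] at this
    rw [Nat.cast_zero, qBinom_natCast_zero hq] at this
    simpa using this
  simp only [mul_add, Finset.sum_add_distrib]
  rw [h1, Finset.sum_range_succ', Nat.cast_zero, qBinom_natCast_zero hq, one_mul, add_right_comm,
    ← Finset.sum_add_distrib]
  congr 1
  refine Finset.sum_congr rfl fun k hk => ?_
  have hk : k ≤ N := by simpa [Nat.lt_succ_iff] using hk
  obtain ⟨c, e1, e2, e3⟩ := qBinom_common hq hk
  rw [e1, e2, e3]
  obtain ⟨d, rfl⟩ := Nat.exists_eq_add_of_le hk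
  rw [Nat.add_sub_cancel_left]
  ring

theorem sum_qBinom_succ_right (hq : ∀ m : ℕ, 1 ≤ m → q ^ m ≠ 1) (N : ℕ) (f : ℕ → K) :
    ∑ k ∈ Finset.range (N + 2), qBinom q (N + 1 : ℕ) k * f k
      = ∑ k ∈ Finset.range (N + 1), qBinom q N k * (q ^ k * f k + f (k + 1)) := by
  have h1 : ∑ k ∈ Finset.range (N + 1), qBinom q N k * (q ^ k * f k)
      = ∑ k ∈ Finset.range (N + 1), qBinom q N (k + 1 : ℕ) * (q ^ (k + 1) * f (k + 1)) + f 0 := by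
    have := Finset.sum_range_succ' (fun k : ℕ => qBinom q N k * (q ^ k * f k)) (N + 1)
    rw [Finset.sum_range_succ, qBinom_of_lt q (by push_cast; omega)] at this
    rw [Nat.cast_zero, qBinom_natCast_zero hq] at this
    simpa using this
  simp only [mul_add, Finset.sum_add_distrib]
  rw [h1, Finset.sum_range_succ', Nat.cast_zero, qBinom_natCast_zero hq, one_mul, add_right_comm,
    ← Finset.sum_add_distrib]
  congr 1
  refine Finset.sum_congr rfl fun k hk => ?_
  have hk : k ≤ N := by simpa [Nat.lt_succ_iff] using hk
  obtain ⟨c, e1, e2, e3⟩ := qBinom_common hq hk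
  rw [e1, e2, e3]
  obtain ⟨d, rfl⟩ := Nat.exists_eq_add_of_le hk
  rw [Nat.add_sub_cancel_left]
  ring

/-- A form of the `q`-Chu–Vandermonde sum. -/
theorem sum_qBinom_mul_pow_mul_recip (hq : ∀ m : ℕ, 1 ≤ m → q ^ m ≠ 1) (M c : ℕ) :
    ∑ s ∈ Finset.range (M + 1), qBinom q M s * (q ^ (s * (s + c)) * qPochRecip q (s + c : ℕ))
      = qPochRecip q (M + c : ℕ) := by
  induction M generalizing c with
  | zero =>
    have := qBinom_natCast_zero hq 0
    simp only [Nat.cast_zero] at this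
    simp [this]
  | succ M ih =>
    rw [sum_qBinom_succ_left hq]
    -- The shifted weight is q^{M+c+1} times the weight for c + 1, which is why c is generalized.
    -- The two sums then add up by 1/(q)_{M+c} = (1 - q^{M+c+1})/(q)_{M+c+1}.
    have key : ∀ k ∈ Finset.range (M + 1),
        qBinom q M k * (q ^ (k * (k + c)) * qPochRecip q (k + c : ℕ)
          + q ^ (M - k) * (q ^ ((k + 1) * (k + 1 + c)) * qPochRecip q (k + 1 + c : ℕ)))
        = qBinom q M k * (q ^ (k * (k + c)) * qPochRecip q (k + c : ℕ))
          + q ^ (M + c + 1) * (qBinom q M k *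
            (q ^ (k * (k + (c + 1))) * qPochRecip q (k + (c + 1) : ℕ))) := by
      intro k hk
      obtain ⟨d, rfl⟩ := Nat.exists_eq_add_of_le (Nat.lt_succ_iff.1 (Finset.mem_range.1 hk))
      rw [Nat.add_sub_cancel_left, show k + 1 + c = k + (c + 1) by ring]
      ring
    rw [Finset.sum_congr rfl key, Finset.sum_add_distrib, ← Finset.mul_sum, ih, ih,
      qPochRecip_eq_succ hq (M + c), show M + 1 + c = M + c + 1 by ring,
      show M + (c + 1) = M + c + 1 by ring]
    push_cast
    ring

/-- The limiting Bailey lemma at a = 1, with N shifted by one and a factor q removed: (N+1)² - 1 =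
(N+2)N. The term lost by the shift matters only for j = 0. For j > 0 the terms with N + 1 < j
vanish, and the rest is Chu–Vandermonde with M = L - j, c = 2j. -/
theorem sum_pow_mul_recip_mul_recip (hq : ∀ m : ℕ, 1 ≤ m → q ^ m ≠ 1) (L : ℕ) {j : ℤ}
    (hj : j ≠ 0) :
    ∑ N ∈ Finset.range L, q ^ ((N + 2) * N) * qPochRecip q ((L : ℤ) - 1 - N)
        * (qPochRecip q ((N + 1 : ℕ) + j) * qPochRecip q ((N + 1 : ℕ) - j))
      = q ^ (j ^ 2 - 1).toNat * (qPochRecip q (L + j) * qPochRecip q (L - j)) := by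
  wlog hpos : 0 < j generalizing j
  · have := this (neg_ne_zero.2 hj) (by omega)
    simpa [mul_comm, sub_neg_eq_add, ← sub_eq_add_neg] using this
  obtain ⟨c, rfl⟩ : ∃ c : ℕ, j = c + 1 := ⟨(j - 1).toNat, by omega⟩
  have hexp : (((c : ℤ) + 1) ^ 2 - 1).toNat = c * (c + 2) := by
    rw [show ((c : ℤ) + 1) ^ 2 - 1 = ((c * (c + 2) : ℕ) : ℤ) by push_cast; ring, Int.toNat_natCast]
  rcases Nat.lt_or_ge c L with hL | hL
  · obtain ⟨M, rfl⟩ := Nat.exists_eq_add_of_lt hL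
    rw [show c + M + 1 = c + (M + 1) by ring, Finset.sum_range_add, Finset.sum_eq_zero, zero_add]
    · have hM := qPoch_self_ne_zero hq M
      have h := sum_qBinom_mul_pow_mul_recip hq M (2 * c + 2)
      rw [show (((c + (M + 1) : ℕ) : ℤ) + (c + 1)) = (M + (2 * c + 2) : ℕ) by push_cast; ring, ← h,
        show (((c + (M + 1) : ℕ) : ℤ) - (c + 1)) = M by push_cast; ring, Finset.sum_mul,
        Finset.mul_sum, hexp]
      refine Finset.sum_congr rfl fun s hs => ?_
      rw [qBinom_eq_recip, qPochRecip_natCast q M,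
        show (((c + (M + 1) : ℕ) : ℤ) - 1 - (c + s : ℕ)) = M - s by push_cast; ring,
        show (((c + s + 1 : ℕ) : ℤ) + (c + 1)) = (s + (2 * c + 2) : ℕ) by push_cast; ring,
        show (((c + s + 1 : ℕ) : ℤ) - (c + 1)) = s by push_cast; ring]
      field_simp
      ring
    · intro N hN
      have := Finset.mem_range.1 hN
      rw [qPochRecip_of_neg q (m := ((N + 1 : ℕ) : ℤ) - (c + 1)) (by push_cast; omega)]
      ring
  · rw [qPochRecip_of_neg q (m := (L : ℤ) - (c + 1)) (by omega), Finset.sum_eq_zero]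
    · ring
    · intro N hN
      have := Finset.mem_range.1 hN
      rw [qPochRecip_of_neg q (m := ((N + 1 : ℕ) : ℤ) - (c + 1)) (by push_cast; omega)]
      ring

/-- The triangular number `j (j - 1) / 2`. -/
def triangular (j : ℤ) : ℕ := (j * (j - 1) / 2).toNat

theorem two_mul_triangular (j : ℤ) : 2 * (triangular j : ℤ) = j * (j - 1) := by
  have h0 : 0 ≤ j * (j - 1) := by
    rcases le_or_gt j 0 with h | h <;> nlinarith
  have h2 : 2 ∣ j * (j - 1) := (Int.even_mul_pred_self j).two_dvd
  unfold triangular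
  omega

/-- The finite form of the Jacobi triple product identity. -/
theorem finite_triple_product (hq : ∀ m : ℕ, 1 ≤ m → q ^ m ≠ 1) (z : K) (a b : ℕ) :
    (∏ m ∈ Finset.range b, (1 + z * q ^ m)) * ∏ m ∈ Finset.range a, (q ^ (m + 1) + z)
      = ∑ k ∈ Finset.range (a + b + 1),
          qBinom q (a + b : ℕ) k * (z ^ k * q ^ triangular (k - a)) := by
  -- A factor q^{a+1} + z is absorbed by the Pascal rule of `sum_qBinom_succ_right`, a factor 1 + z
  -- q^b by that of `sum_qBinom_succ_left`.
  induction b with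
  | zero =>
    induction a with
    | zero =>
      have := qBinom_natCast_zero hq 0
      simp only [Nat.cast_zero] at this
      simp [this, triangular]
    | succ a ih =>
      rw [Finset.prod_range_zero, one_mul] at ih ⊢
      rw [Finset.prod_range_succ, ih, add_zero, add_zero, sum_qBinom_succ_right hq, Finset.sum_mul]
      refine Finset.sum_congr rfl fun k hk => ?_
      have e1 : k + triangular ((k : ℤ) - (a + 1 : ℕ)) = triangular ((k : ℤ) - a) + (a + 1) := by
        have h1 := two_mul_triangular ((k : ℤ) - (a + 1 : ℕ))
        have h2 := two_mul_triangular ((k : ℤ) - a)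
        push_cast at h1
        zify
        linarith
      have e2 : q ^ k * q ^ triangular ((k : ℤ) - (a + 1 : ℕ))
          = q ^ triangular ((k : ℤ) - a) * q ^ (a + 1) := by rw [← pow_add, e1, pow_add]
      rw [show (((k + 1 : ℕ) : ℤ) - (a + 1 : ℕ)) = k - a by push_cast; ring]
      linear_combination (-qBinom q a k * z ^ k) * e2
  | succ b ih =>
    rw [Finset.prod_range_succ, mul_right_comm, ih, ← add_assoc a b 1, sum_qBinom_succ_left hq,
      Finset.sum_mul]
    refine Finset.sum_congr rfl fun k hk => ?_
    have hk : k ≤ a + b := by simpa [Nat.lt_succ_iff] using hk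
    have e1 : (a + b - k) + triangular (((k + 1 : ℕ) : ℤ) - a) = b + triangular ((k : ℤ) - a) := by
      have h1 := two_mul_triangular (((k + 1 : ℕ) : ℤ) - a)
      have h2 := two_mul_triangular ((k : ℤ) - a)
      push_cast at h1
      zify [hk]
      linarith
    have e2 : q ^ (a + b - k) * q ^ triangular (((k + 1 : ℕ) : ℤ) - a)
        = q ^ b * q ^ triangular ((k : ℤ) - a) := by rw [← pow_add, e1, pow_add]
    linear_combination (-qBinom q (a + b : ℕ) k * z ^ (k + 1)) * e2

end Finite

/-! ### The Legendre symbol modulo 3 and the seed v = 0. -/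

section Legendre

theorem legendreSym_three_eq (n : ℤ) (r : ℤ) (h : n % 3 = r) : legendreSym 3 n = legendreSym 3 r := by
  rw [legendreSym.mod, ← h]
  rfl

theorem legendreSym_three_of_mod_zero {n : ℤ} (h : n % 3 = 0) : legendreSym 3 n = 0 := by
  rw [legendreSym_three_eq n 0 h]; decide

theorem legendreSym_three_of_mod_one {n : ℤ} (h : n % 3 = 1) : legendreSym 3 n = 1 := by
  rw [legendreSym_three_eq n 1 h]; decide

theorem legendreSym_three_of_mod_two {n : ℤ} (h : n % 3 = 2) : legendreSym 3 n = -1 := by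
  rw [legendreSym_three_eq n 2 h]; decide

variable {K : Type*} [Field K] {q : K}

/-- The character modulo 3 as a combination of powers of ω; both sides have period 3 in n. -/
theorem legendreSym_three_mul_sub (ω : K) (hω : ω ^ 2 + ω + 1 = 0) (n : ℕ) :
    (legendreSym 3 n : K) * (ω - ω ^ 2) = ω ^ n - (ω ^ 2) ^ n := by
  have h3 : ω ^ 3 = 1 := by linear_combination (ω - 1) * hω
  have h6 : (ω ^ 2) ^ 3 = 1 := by rw [← pow_mul, mul_comm, pow_mul, h3, one_pow]
  conv_rhs => rw [← Nat.div_add_mod n 3, pow_add, pow_add, pow_mul, pow_mul (ω ^ 2), h3, h6,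
    one_pow, one_mul, one_mul]
  have hlt : n % 3 < 3 := Nat.mod_lt _ (by norm_num)
  interval_cases h : n % 3
  · rw [legendreSym_three_of_mod_zero (by omega)]
    simp
  · rw [legendreSym_three_of_mod_one (by omega)]
    simp
  · rw [legendreSym_three_of_mod_two (by omega)]
    push_cast
    linear_combination (ω ^ 2 - ω) * hω

/-- A natural exponent, usable also at q = 0, in which v enters only through v(j² - 1). The
truncation at j = 0 is harmless because the symbol vanishes there. -/
theorem legendreTerm_eq (q : K) (v : ℕ) (j : ℤ) :
    legendreTerm q v j
      = (legendreSym 3 j : K) * q ^ (triangular (j - 1) + v * (j ^ 2 - 1).toNat) := by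
  rcases eq_or_ne j 0 with rfl | hj
  · simp [legendreTerm, legendreSym_three_of_mod_zero (show (0 : ℤ) % 3 = 0 by rfl)]
  · have hj2 : 0 ≤ j ^ 2 - 1 := by
      have : 0 < j ^ 2 := by positivity
      omega
    have ht := two_mul_triangular (j - 1)
    have hexp : ((2 * (v : ℤ) + 1) * j ^ 2 - 3 * j) / 2 - ((v : ℤ) - 1)
        = ((triangular (j - 1) + v * (j ^ 2 - 1).toNat : ℕ) : ℤ) := by
      push_cast
      rw [Int.toNat_of_nonneg hj2]
      have : (2 * (v : ℤ) + 1) * j ^ 2 - 3 * j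
          = 2 * (triangular (j - 1) + v * (j ^ 2 - 1) + ((v : ℤ) - 1)) := by linarith
      rw [this, Int.mul_ediv_cancel_left _ (by norm_num)]
      ring
    rw [legendreTerm, hexp, zpow_natCast]

theorem legendreTerm_zero_right (q : K) (v : ℕ) : legendreTerm q v 0 = 0 := by
  simp [legendreTerm, legendreSym_three_of_mod_zero (show (0 : ℤ) % 3 = 0 by rfl)]

theorem legendreTerm_succ (q : K) (v : ℕ) (j : ℤ) :
    legendreTerm q (v + 1) j = q ^ (j ^ 2 - 1).toNat * legendreTerm q v j := by
  rw [legendreTerm_eq, legendreTerm_eq]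
  ring

/-- Multiplying by the missing factor q^0 + ω aligns the two products, whose factors pair as
(1+ωx)(x+ω) = ω(1-x+x²) with x = q^m. Three factors are left over, and 1 + ω = -ω² is cancelled at
the end. -/
theorem triple_product_at_root (ω : K) (hω : ω ^ 2 + ω + 1 = 0) (q : K) (M : ℕ) :
    (∏ m ∈ Finset.range M, (1 + ω * q ^ m)) * ∏ m ∈ Finset.range (M + 2), (q ^ (m + 1) + ω)
      = -(ω ^ (M + 1) * ((q ^ M + ω) * (q ^ (M + 1) + ω) * (q ^ (M + 2) + ω)
        * ∏ m ∈ Finset.range M, (1 - q ^ m + q ^ (2 * m)))) := by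
  have h1 : (1 + ω) * ∏ m ∈ Finset.range (M + 2), (q ^ (m + 1) + ω)
      = (∏ m ∈ Finset.range M, (q ^ m + ω)) * ((q ^ M + ω) * (q ^ (M + 1) + ω) * (q ^ (M + 2) + ω)) := by
    have := Finset.prod_range_succ' (fun m => q ^ m + ω) (M + 2)
    rw [pow_zero, mul_comm] at this
    rw [← this, Finset.prod_range_succ, Finset.prod_range_succ, Finset.prod_range_succ]
    ring
  have h2 : (∏ m ∈ Finset.range M, (1 + ω * q ^ m)) * ∏ m ∈ Finset.range M, (q ^ m + ω)
      = ω ^ M * ∏ m ∈ Finset.range M, (1 - q ^ m + q ^ (2 * m)) := by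
    rw [← Finset.prod_mul_distrib, ← Finset.card_range M, ← Finset.prod_const, Finset.card_range,
      ← Finset.prod_mul_distrib]
    refine Finset.prod_congr rfl fun m _ => ?_
    rw [mul_comm 2 m, pow_mul]
    linear_combination (q ^ m) * hω
  have hω0 : ω ≠ 0 := by
    rintro rfl
    simp at hω
  have h3 : 1 + ω ≠ 0 := by
    intro h
    apply pow_ne_zero 2 hω0
    linear_combination hω - h
  apply mul_left_cancel₀ h3
  rw [mul_left_comm, h1, ← mul_assoc, h2]
  linear_combination (ω ^ M * (∏ m ∈ Finset.range M, (1 - q ^ m + q ^ (2 * m))) *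
    ((q ^ M + ω) * (q ^ (M + 1) + ω) * (q ^ (M + 2) + ω))) * hω

theorem sum_legendreTerm_zero_of_root (hq : ∀ m : ℕ, 1 ≤ m → q ^ m ≠ 1) (ω : K)
    (hω : ω ^ 2 + ω + 1 = 0) (hne : ω - ω ^ 2 ≠ 0) (M : ℕ) :
    ∑ k ∈ Finset.range (2 * M + 3),
        legendreTerm q 0 (k - (M + 1)) * qBinom q (2 * M + 2 : ℕ) k
      = (1 + q + q ^ 2) * q ^ M * (1 - q ^ (M + 1))
        * ∏ m ∈ Finset.range M, (1 - q ^ m + q ^ (2 * m)) := by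
  have h3 : ω ^ 3 = 1 := by linear_combination (ω - 1) * hω
  have hω' : (ω ^ 2) ^ 2 + ω ^ 2 + 1 = 0 := by linear_combination (ω ^ 2 - ω + 1) * hω
  have hP : ∀ z : K, z ^ 2 + z + 1 = 0 →
      ∑ k ∈ Finset.range (2 * M + 3), z ^ (k + 2 * M + 2)
        * (q ^ triangular ((k : ℤ) - (M + 1) - 1) * qBinom q (2 * M + 2 : ℕ) k)
      = -((q ^ M + z) * (q ^ (M + 1) + z) * (q ^ (M + 2) + z)
        * ∏ m ∈ Finset.range M, (1 - q ^ m + q ^ (2 * m))) := by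
    intro z hz
    have h := finite_triple_product hq z (M + 2) M
    have hz3 : z ^ 3 = 1 := by linear_combination (z - 1) * hz
    -- Modulo 3, 2M + 2 ≡ -(M + 1), so this power recentres z^k to z^{k-(M+1)} without negative
    -- exponents.
    have hz' : z ^ (2 * M + 2) * z ^ (M + 1) = 1 := by
      rw [← pow_add, show 2 * M + 2 + (M + 1) = 3 * (M + 1) by ring, pow_mul, hz3, one_pow]
    rw [triple_product_at_root z hz] at h
    rw [show M + 2 + M = 2 * M + 2 by ring] at h
    have h' := congrArg (fun t => z ^ (2 * M + 2) * t) h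
    simp only [Finset.mul_sum] at h'
    calc _ = _ := ?_
      _ = _ := h'.symm
      _ = _ := by
        linear_combination (-((q ^ M + z) * (q ^ (M + 1) + z) * (q ^ (M + 2) + z)
          * ∏ m ∈ Finset.range M, (1 - q ^ m + q ^ (2 * m)))) * hz'
    refine Finset.sum_congr rfl fun k _ => ?_
    rw [show (k : ℤ) - (M + 1) - 1 = k - (M + 2 : ℕ) by push_cast; ring]
    ring
  apply mul_right_cancel₀ hne
  rw [Finset.sum_mul]
  have hterm : ∀ k ∈ Finset.range (2 * M + 3),
      legendreTerm q 0 (k - (M + 1)) * qBinom q (2 * M + 2 : ℕ) k * (ω - ω ^ 2)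
      = ω ^ (k + 2 * M + 2)
          * (q ^ triangular ((k : ℤ) - (M + 1) - 1) * qBinom q (2 * M + 2 : ℕ) k)
        - (ω ^ 2) ^ (k + 2 * M + 2)
          * (q ^ triangular ((k : ℤ) - (M + 1) - 1) * qBinom q (2 * M + 2 : ℕ) k) := by
    intro k _
    rw [← sub_mul, ← legendreSym_three_mul_sub ω hω, legendreTerm_eq,
      legendreSym_three_eq ((k : ℤ) - (M + 1)) (((k + 2 * M + 2 : ℕ) : ℤ) % 3) (by omega),
      ← legendreSym_three_eq ((k + 2 * M + 2 : ℕ) : ℤ) _ rfl, zero_mul, add_zero]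
    ring
  rw [Finset.sum_congr rfl hterm, Finset.sum_sub_distrib, hP ω hω, hP _ hω']
  have e : ω ^ 4 = ω := by linear_combination ω * h3
  set R := ∏ m ∈ Finset.range M, (1 - q ^ m + q ^ (2 * m))
  set x := q ^ M with hx
  rw [pow_add, pow_add q M 2, ← hx, pow_one]
  -- In the difference of (x+z)(xq+z)(xq²+z) at z = ω and z = ω², only the z and z² terms survive,
  -- giving x(1+q+q²)(1-xq)(ω-ω²).
  linear_combination R * x * (1 + q + q ^ 2) * e + R * (ω ^ 3) * h3

theorem qPoch_map {K' : Type*} [Field K'] (f : K →+* K') (a q : K) (n : ℕ) :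
    f (qPoch a q n) = qPoch (f a) (f q) n := by
  simp [qPoch]

theorem qBinom_map {K' : Type*} [Field K'] (f : K →+* K') (q : K) (N k : ℤ) :
    f (qBinom q N k) = qBinom (f q) N k := by
  unfold qBinom
  split_ifs <;> simp [qPoch_map]

theorem legendreTerm_map {K' : Type*} [Field K'] (f : K →+* K') (q : K) (v : ℕ) (j : ℤ) :
    f (legendreTerm q v j) = legendreTerm (f q) v j := by
  simp [legendreTerm]

theorem sum_legendreTerm_zero [CharZero K] (hq : ∀ m : ℕ, 1 ≤ m → q ^ m ≠ 1) (M : ℕ) :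
    ∑ k ∈ Finset.range (2 * M + 3),
        legendreTerm q 0 (k - (M + 1)) * qBinom q (2 * M + 2 : ℕ) k
      = (1 + q + q ^ 2) * q ^ M * (1 - q ^ (M + 1))
        * ∏ m ∈ Finset.range M, (1 - q ^ m + q ^ (2 * m)) := by
  let f := algebraMap K (AlgebraicClosure K)
  have hf : Function.Injective f := f.injective
  obtain ⟨ω, hω⟩ : ∃ ω : AlgebraicClosure K, ω ^ 2 + ω + 1 = 0 := by
    have hdeg : ((Polynomial.X ^ 2 + Polynomial.X + 1 : Polynomial (AlgebraicClosure K))).degree ≠ 0 := by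
      have : ((Polynomial.X ^ 2 + Polynomial.X + 1 : Polynomial (AlgebraicClosure K))).degree = 2 := by
        compute_degree!
      rw [this]
      norm_num
    obtain ⟨ω, h⟩ := IsAlgClosed.exists_root _ hdeg
    exact ⟨ω, by simpa [Polynomial.IsRoot] using h⟩
  have : CharZero (AlgebraicClosure K) := charZero_of_injective_algebraMap hf
  -- (ω - ω²)² = -3, nonzero in characteristic 0.
  have hne : ω - ω ^ 2 ≠ 0 := by
    intro h
    have : (3 : AlgebraicClosure K) = 0 := by
      linear_combination (ω ^ 2 - 3 * ω + 3) * hω - (ω - ω ^ 2) * h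
    norm_num at this
  apply hf
  have := sum_legendreTerm_zero_of_root (q := f q)
    (fun m hm h => hq m hm (hf (by simpa using h))) ω hω hne M
  simpa [qBinom_map, legendreTerm_map] using this

end Legendre

/-! ### The Bailey chain and the finite identity. -/

section Multisum

theorem tailSum_cons_succ {v : ℕ} (a : ℕ) (n : Fin v → ℕ) (i : Fin v) :
    tailSum (Fin.cons a n : Fin (v + 1) → ℕ) i.succ = tailSum n i := by
  unfold tailSum
  rw [← Fin.map_succEmb_Ici, Finset.sum_map]
  simp

theorem tailSum_cons_zero {v : ℕ} (a : ℕ) (n : Fin (v + 1) → ℕ) :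
    tailSum (Fin.cons a n : Fin (v + 2) → ℕ) 0 = a + tailSum n 0 := by
  unfold tailSum
  rw [show (Finset.Ici (0 : Fin (v + 2))) = Finset.univ from Finset.Ici_bot,
    show (Finset.Ici (0 : Fin (v + 1))) = Finset.univ from Finset.Ici_bot, Fin.sum_univ_succ]
  simp

theorem prod_erase_succ {M : Type*} [CommMonoid M] {v : ℕ} (l : Fin v) (f : Fin (v + 1) → M) :
    ∏ i ∈ Finset.univ.erase l.succ, f i = f 0 * ∏ i ∈ Finset.univ.erase l, f i.succ := by
  have h : (Finset.univ.erase l.succ : Finset (Fin (v + 1)))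
      = insert 0 ((Finset.univ.erase l).map (Fin.succEmb v)) := by
    ext i
    refine Fin.cases ?_ (fun i => ?_) i
    · simp [(Fin.succ_ne_zero l).symm]
    · simp [Fin.succ_ne_zero]
  rw [h, Finset.prod_insert (by simp [Fin.succ_ne_zero]), Finset.prod_map]
  simp

variable {K : Type*} [Field K] {q : K}

/-- The part of the summand that depends only on the last index. -/
def innerTerm (q : K) (n : ℕ) : K :=
  q ^ n * (1 - q ^ (1 + n)) / qPoch q q (2 * n + 2) * (qPoch (-1) (q ^ 3) n / qPoch (-1) q n)

theorem multisumTerm_one (q : K) (n : Fin 1 → ℕ) :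
    multisumTerm q 1 le_rfl n = q ^ ((n 0 + 2) * n 0) * innerTerm q (n 0) := by
  have h1 : lastIdx 1 le_rfl = 0 := rfl
  have h2 : tailSum n 0 = n 0 := by
    rw [tailSum, show (Finset.Ici (0 : Fin 1)) = Finset.univ from Finset.Ici_bot]
    simp
  rw [multisumTerm, innerTerm, h1, show (Finset.univ.erase (0 : Fin 1)) = ∅ from rfl]
  simp only [Fin.sum_univ_one, h2, Finset.prod_empty, one_mul, pow_add]
  ring

theorem multisumTerm_cons (q : K) (v : ℕ) (a : ℕ) (n : Fin (v + 1) → ℕ) :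
    multisumTerm q (v + 2) (Nat.le_add_left _ _) (Fin.cons a n)
      = q ^ ((a + tailSum n 0 + 2) * (a + tailSum n 0)) * (qPoch q q a)⁻¹
        * multisumTerm q (v + 1) (Nat.le_add_left _ _) n := by
  have h1 : lastIdx (v + 2) (Nat.le_add_left _ _)
      = (lastIdx (v + 1) (Nat.le_add_left _ _)).succ := rfl
  unfold multisumTerm
  rw [h1, prod_erase_succ, Fin.sum_univ_succ]
  simp only [Fin.cons_succ, Fin.cons_zero, tailSum_cons_succ, tailSum_cons_zero, pow_add,
    div_eq_mul_inv, mul_inv]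
  ring

/-- The bilateral sum, divided by `(q)_{2L}`. -/
def bilateralSum (q : K) (v L : ℕ) : K :=
  ∑ j ∈ Finset.Icc (-(L : ℤ)) L, legendreTerm q v j * (qPochRecip q (L + j) * qPochRecip q (L - j))

/-- A common range of j for all L ≤ B allows the sums over j and N to be interchanged. -/
theorem bilateralSum_eq_of_le (q : K) (v : ℕ) {L B : ℕ} (h : L ≤ B) :
    bilateralSum q v L = ∑ j ∈ Finset.Icc (-(B : ℤ)) B,
      legendreTerm q v j * (qPochRecip q (L + j) * qPochRecip q (L - j)) := by
  refine Finset.sum_subset (Finset.Icc_subset_Icc (by omega) (by omega)) fun j _ hj => ?_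
  rw [Finset.mem_Icc] at hj
  rcases lt_or_ge ((L : ℤ) + j) 0 with h1 | h1
  · rw [qPochRecip_of_neg q h1]
    ring
  · rw [qPochRecip_of_neg q (m := (L : ℤ) - j) (by omega)]
    ring

theorem bilateralSum_succ (hq : ∀ m : ℕ, 1 ≤ m → q ^ m ≠ 1) (v L : ℕ) :
    bilateralSum q (v + 1) L = ∑ N ∈ Finset.range L,
      q ^ ((N + 2) * N) * qPochRecip q ((L : ℤ) - 1 - N) * bilateralSum q v (N + 1) := by
  have h : ∀ N ∈ Finset.range L,
      q ^ ((N + 2) * N) * qPochRecip q ((L : ℤ) - 1 - N) * bilateralSum q v (N + 1)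
      = ∑ j ∈ Finset.Icc (-(L : ℤ)) L, legendreTerm q v j *
        (q ^ ((N + 2) * N) * qPochRecip q ((L : ℤ) - 1 - N)
        * (qPochRecip q ((N + 1 : ℕ) + j) * qPochRecip q ((N + 1 : ℕ) - j))) := by
    intro N hN
    rw [bilateralSum_eq_of_le q v (Nat.succ_le_of_lt (Finset.mem_range.1 hN)), Finset.mul_sum]
    exact Finset.sum_congr rfl fun j _ => by ring
  rw [Finset.sum_congr rfl h, Finset.sum_comm, bilateralSum]
  refine Finset.sum_congr rfl fun j _ => ?_
  rw [← Finset.mul_sum]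
  rcases eq_or_ne j 0 with rfl | hj
  · simp [legendreTerm_zero_right]
  · rw [sum_pow_mul_recip_mul_recip hq L hj, legendreTerm_succ]
    ring

theorem one_add_pow_ne_zero [CharZero K] (hq : ∀ m : ℕ, 1 ≤ m → q ^ m ≠ 1) (m : ℕ) :
    1 + q ^ m ≠ 0 := by
  rcases Nat.eq_zero_or_pos m with rfl | hm
  · rw [pow_zero]
    norm_num
  · intro h
    apply hq (m * 2) (by omega)
    rw [pow_mul]
    linear_combination (q ^ m - 1) * h

/-- Factorwise 1 + x³ = (1 + x)(1 - x + x²) with x = q^m. At m = 0 the divisor is 2, whence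
characteristic 0. -/
theorem qPoch_neg_one_div [CharZero K] (hq : ∀ m : ℕ, 1 ≤ m → q ^ m ≠ 1) (n : ℕ) :
    qPoch (-1) (q ^ 3) n / qPoch (-1) q n
      = ∏ m ∈ Finset.range n, (1 - q ^ m + q ^ (2 * m)) := by
  unfold qPoch
  rw [← Finset.prod_div_distrib]
  refine Finset.prod_congr rfl fun m _ => ?_
  have h := one_add_pow_ne_zero hq m
  rw [div_eq_iff (by simpa using h), ← pow_mul, mul_comm 3 m, mul_comm 2 m, pow_mul, pow_mul]
  ring

theorem bilateralSum_zero_left [CharZero K] (hq : ∀ m : ℕ, 1 ≤ m → q ^ m ≠ 1) (n : ℕ) :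
    bilateralSum q 0 (n + 1) = (1 + q + q ^ 2) * innerTerm q n := by
  have h := sum_legendreTerm_zero hq n
  have hne := qPoch_self_ne_zero hq (2 * n + 2)
  rw [innerTerm, qPoch_neg_one_div hq]
  have hsum : qPoch q q (2 * n + 2) * bilateralSum q 0 (n + 1)
      = ∑ k ∈ Finset.range (2 * n + 3),
        legendreTerm q 0 (k - (n + 1)) * qBinom q (2 * n + 2 : ℕ) k := by
    rw [bilateralSum, Finset.mul_sum]
    refine Finset.sum_nbij' (fun j : ℤ => (j + (n + 1)).toNat) (fun k : ℕ => (k : ℤ) - (n + 1))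
      ?_ ?_ ?_ ?_ ?_
    · intro j hj
      simp only [Finset.mem_Icc, Finset.mem_range] at hj ⊢
      omega
    · intro k hk
      simp only [Finset.mem_Icc, Finset.mem_range] at hk ⊢
      omega
    · intro j hj
      simp only [Finset.mem_Icc] at hj
      omega
    · intro k hk
      omega
    · intro j hj
      simp only [Finset.mem_Icc] at hj
      rw [Int.toNat_of_nonneg (by omega), add_sub_cancel_right, qBinom_eq_recip]
      push_cast
      rw [show (n : ℤ) + 1 + j = j + (n + 1) by ring,
        show (n : ℤ) + 1 - j = 2 * n + 2 - (j + (n + 1)) by ring]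
      ring
  rw [h] at hsum
  rw [add_comm 1 n]
  field_simp
  linear_combination hsum

/-- The multisum over the box `{0, …, B - 1}^v`. -/
def boxSum (q : K) (v : ℕ) (L B : ℕ) : K :=
  ∑ n ∈ Fintype.piFinset fun _ : Fin (v + 1) => Finset.range B,
    multisumTerm q (v + 1) (Nat.le_add_left _ _) n * qPochRecip q ((L : ℤ) - 1 - tailSum n 0)

theorem sum_piFinset_succ {M : Type*} [AddCommMonoid M] {v : ℕ} (s : Finset ℕ)
    (f : (Fin (v + 1) → ℕ) → M) :
    ∑ n ∈ Fintype.piFinset (fun _ : Fin (v + 1) => s), f n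
      = ∑ n ∈ Fintype.piFinset (fun _ : Fin v => s), ∑ a ∈ s, f (Fin.cons a n) := by
  rw [← Finset.sum_product']
  refine Finset.sum_nbij' (fun n => (Fin.tail n, n 0)) (fun p => Fin.cons p.2 p.1) ?_ ?_ ?_ ?_ ?_
  · intro n hn
    simp only [Finset.mem_product, Fintype.mem_piFinset] at hn ⊢
    exact ⟨fun i => hn _, hn 0⟩
  · intro p hp
    simp only [Finset.mem_product, Fintype.mem_piFinset] at hp ⊢
    exact Fin.cases hp.2 hp.1
  · intro n _
    simp
  · intro p _
    simp
  · intro n _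
    simp

/-- Substitute N = a + t. Terms with N < t die by 1/(q)_{N-t} and those with N ≥ L by 1/(q)_{L-1-N},
so any box with B ≥ L gives the same sum. -/
theorem sum_range_shift (q : K) {L B : ℕ} (h : L ≤ B) (t : ℕ) (f : ℕ → K) :
    ∑ a ∈ Finset.range B, f (a + t) * (qPoch q q a)⁻¹ * qPochRecip q ((L : ℤ) - 1 - (a + t : ℕ))
      = ∑ N ∈ Finset.range L, f N * qPochRecip q ((N : ℤ) - t) * qPochRecip q ((L : ℤ) - 1 - N) := by
  have h1 : ∑ N ∈ Finset.range L, f N * qPochRecip q ((N : ℤ) - t) * qPochRecip q ((L : ℤ) - 1 - N)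
      = ∑ N ∈ Finset.range (t + B),
        f N * qPochRecip q ((N : ℤ) - t) * qPochRecip q ((L : ℤ) - 1 - N) := by
    refine Finset.sum_subset (Finset.range_mono (by omega)) fun N _ hN => ?_
    rw [Finset.mem_range] at hN
    rw [qPochRecip_of_neg q (m := (L : ℤ) - 1 - N) (by omega), mul_zero]
  rw [h1, Finset.sum_range_add, Finset.sum_eq_zero (s := Finset.range t), zero_add]
  · refine Finset.sum_congr rfl fun a _ => ?_
    rw [add_comm t a, show ((a + t : ℕ) : ℤ) - t = a by push_cast; ring, qPochRecip_natCast]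
  · intro N hN
    rw [Finset.mem_range] at hN
    rw [qPochRecip_of_neg q (m := (N : ℤ) - t) (by omega)]
    ring

/-- With N = N_1, the factor 1/(q)_{n_1} equals 1/(q)_{(N+1)-1-N_2}, exactly the cutoff factor of
the shorter multisum at level N + 1. The recurrence is therefore that of `bilateralSum_succ`. -/
theorem boxSum_succ (q : K) (v : ℕ) {L B : ℕ} (h : L ≤ B) :
    boxSum q (v + 1) L B = ∑ N ∈ Finset.range L,
      q ^ ((N + 2) * N) * qPochRecip q ((L : ℤ) - 1 - N) * boxSum q v (N + 1) B := by
  rw [boxSum, sum_piFinset_succ]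
  simp only [multisumTerm_cons, tailSum_cons_zero, boxSum, Finset.mul_sum]
  rw [Finset.sum_comm (s := Finset.range L)]
  refine Finset.sum_congr rfl fun n _ => ?_
  have := sum_range_shift q h (tailSum n 0)
    (fun N => q ^ ((N + 2) * N) * multisumTerm q (v + 1) (Nat.le_add_left _ _) n)
  refine (Finset.sum_congr rfl fun a _ => ?_).trans (this.trans (Finset.sum_congr rfl fun N _ => ?_))
  · ring
  · rw [show (((N + 1 : ℕ) : ℤ) - 1 - tailSum n 0) = N - tailSum n 0 by push_cast; ring]
    ring

theorem boxSum_zero (q : K) {L B : ℕ} (h : L ≤ B) :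
    boxSum q 0 L B = ∑ N ∈ Finset.range L,
      q ^ ((N + 2) * N) * qPochRecip q ((L : ℤ) - 1 - N) * innerTerm q N := by
  rw [boxSum, sum_piFinset_succ]
  have htail : ∀ n : Fin 1 → ℕ, tailSum n 0 = n 0 := by
    intro n
    rw [tailSum, show (Finset.Ici (0 : Fin 1)) = Finset.univ from Finset.Ici_bot]
    simp
  have hone : ∀ n : Fin 1 → ℕ, multisumTerm q (0 + 1) (Nat.le_add_left _ _) n
      = q ^ ((n 0 + 2) * n 0) * innerTerm q (n 0) := multisumTerm_one q
  rw [Fintype.piFinset_of_isEmpty, Finset.univ_unique, Finset.sum_singleton]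
  simp only [htail, hone, Fin.cons_zero]
  symm
  refine (Finset.sum_subset (Finset.range_mono h) fun N _ hN => ?_).trans
    (Finset.sum_congr rfl fun N _ => by ring)
  rw [Finset.mem_range] at hN
  rw [qPochRecip_of_neg q (m := (L : ℤ) - 1 - N) (by omega)]
  ring

theorem boxSum_eq_bilateralSum [CharZero K] (hq : ∀ m : ℕ, 1 ≤ m → q ^ m ≠ 1) (v : ℕ) {L B : ℕ}
    (h : L ≤ B) : (1 + q + q ^ 2) * boxSum q v L B = bilateralSum q (v + 1) L := by
  induction v generalizing L with
  | zero =>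
    rw [boxSum_zero q h, bilateralSum_succ hq, Finset.mul_sum]
    refine Finset.sum_congr rfl fun N _ => ?_
    rw [bilateralSum_zero_left hq]
    ring
  | succ v ih =>
    rw [boxSum_succ q v h, bilateralSum_succ hq, Finset.mul_sum]
    refine Finset.sum_congr rfl fun N hN => ?_
    rw [← ih (L := N + 1) (by have := Finset.mem_range.1 hN; omega)]
    ring

theorem le_tailSum_zero {v : ℕ} (n : Fin (v + 1) → ℕ) (i : Fin (v + 1)) : n i ≤ tailSum n 0 :=
  Finset.single_le_sum (f := n) (fun _ _ => Nat.zero_le _) (Finset.mem_Ici.2 (Fin.zero_le i))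

theorem support_finiteMultisumTerm_subset (q : K) (v L : ℕ) :
    Function.support (finiteMultisumTerm q (v + 1) (Nat.le_add_left _ _) L)
      ⊆ ↑(Fintype.piFinset fun _ : Fin (v + 1) => Finset.range L) := by
  intro n hn
  simp only [Finset.mem_coe, Fintype.mem_piFinset, Finset.mem_range]
  intro i
  by_contra hi
  apply hn
  have h1 := le_tailSum_zero n i
  have h2 : firstIdx (v + 1) (Nat.le_add_left _ _) = 0 := rfl
  rw [finiteMultisumTerm, h2, qPochRecip_of_neg q (by omega)]
  ring

theorem support_legendreTerm_mul_qBinom_subset (q : K) (v L : ℕ) :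
    (Function.support fun j : ℤ => legendreTerm q v j * qBinom q (2 * L) (L + j))
      ⊆ ↑(Finset.Icc (-(L : ℤ)) L) := by
  intro j hj
  by_contra hmem
  apply hj
  rw [Finset.mem_coe, Finset.mem_Icc] at hmem
  have : ¬ (0 ≤ (L : ℤ) + j ∧ (L : ℤ) + j ≤ 2 * L) := by omega
  simp [qBinom, this]

theorem finsum_finiteMultisumTerm (q : K) (v L : ℕ) :
    ∑ᶠ n, finiteMultisumTerm q (v + 1) (Nat.le_add_left _ _) L n
      = qPoch q q (2 * L) * boxSum q v L L := by
  rw [finsum_eq_sum_of_support_subset _ (support_finiteMultisumTerm_subset q v L), boxSum,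
    Finset.mul_sum]
  refine Finset.sum_congr rfl fun n _ => ?_
  have h2 : firstIdx (v + 1) (Nat.le_add_left _ _) = 0 := rfl
  rw [finiteMultisumTerm, h2]
  ring

theorem finsum_legendreTerm_mul_qBinom (q : K) (v L : ℕ) :
    ∑ᶠ j : ℤ, legendreTerm q v j * qBinom q (2 * L) (L + j)
      = qPoch q q (2 * L) * bilateralSum q v L := by
  rw [finsum_eq_sum_of_support_subset _ (support_legendreTerm_mul_qBinom_subset q v L),
    bilateralSum, Finset.mul_sum]
  refine Finset.sum_congr rfl fun j _ => ?_
  rw [show (2 * (L : ℤ)) = (2 * L : ℕ) by push_cast; ring, qBinom_eq_recip,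
    show ((2 * L : ℕ) : ℤ) - (L + j) = L - j by push_cast; ring]
  ring

theorem finite_identity [CharZero K] (hq : ∀ m : ℕ, 1 ≤ m → q ^ m ≠ 1) (v L : ℕ) :
    (1 - q ^ 3) / (1 - q) * ∑ᶠ n, finiteMultisumTerm q (v + 1) (Nat.le_add_left _ _) L n
      = ∑ᶠ j : ℤ, legendreTerm q (v + 1) j * qBinom q (2 * L) (L + j) := by
  have h1 : 1 - q ≠ 0 := by simpa using one_sub_pow_succ_ne_zero hq 0
  rw [finsum_finiteMultisumTerm, finsum_legendreTerm_mul_qBinom,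
    ← boxSum_eq_bilateralSum hq v le_rfl]
  field_simp
  ring

end Multisum

/-! ### The terminating quintuple product. -/

section Quintuple

variable {K : Type*} [Field K] {q z : K}

theorem qPoch_ne_zero_of_forall (a q : K) (h : ∀ i : ℕ, a * q ^ i ≠ 1) (n : ℕ) : qPoch a q n ≠ 0 :=
  Finset.prod_ne_zero_iff.2 fun i _ => sub_ne_zero.2 (h i).symm

/-- The finite form of the quintuple product identity. -/
theorem finite_quintuple_product (hq : ∀ m : ℕ, 1 ≤ m → q ^ m ≠ 1)
    (hz : ∀ i : ℕ, z ^ 2 * q ^ i ≠ 1) (n : ℕ) :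
    ∑ k ∈ Finset.range (n + 1), qBinom q n k * ((1 + z * q ^ k) * qPoch z q (n + 1)
      / qPoch (z ^ 2 * q ^ k) q (n + 1) * (z ^ k * q ^ (k ^ 2))) = 1 := by
  have hD : ∀ k r, qPoch (z ^ 2 * q ^ k) q r ≠ 0 := fun k r =>
    qPoch_ne_zero_of_forall _ _ (fun i => by rw [mul_assoc, ← pow_add]; exact hz _) r
  have hD1 : ∀ k, 1 - z ^ 2 * q ^ k ≠ 0 := fun k => sub_ne_zero.2 (hz k).symm
  induction n with
  | zero =>
    have h0 := qBinom_natCast_zero hq 0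
    simp only [Nat.cast_zero] at h0
    have h1 := hD1 0
    simp only [pow_zero, mul_one] at h1
    simp only [zero_add, Finset.sum_range_one, Nat.cast_zero, h0, pow_zero, mul_one, one_mul,
      qPoch_succ, qPoch_zero, ne_eq, OfNat.ofNat_ne_zero, not_false_eq_true, zero_pow]
    field_simp
    ring
  | succ n ih =>
    set s : ℕ → ℕ → K := fun n k => (1 + z * q ^ k) * qPoch z q (n + 1)
      / qPoch (z ^ 2 * q ^ k) q (n + 1) * (z ^ k * q ^ (k ^ 2)) with hs
    -- The summand at level n splits as A k + B k so that, at level n + 1, [n+1;k+1] s(k+1) =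
    -- [n;k+1] A(k+1) + [n;k] B(k). Summing regroups level n + 1 into level n.
    set A : ℕ → K := fun k => qPoch z q (n + 1) * (z ^ k * q ^ (k ^ 2))
      * (1 + z * q ^ k - z * q ^ (k + n + 1) * (1 + z)) / qPoch (z ^ 2 * q ^ k) q (n + 2) with hA
    set B : ℕ → K := fun k => qPoch z q (n + 1) * (z ^ (k + 1) * q ^ (k ^ 2 + k + n + 1))
      / qPoch (z ^ 2 * q ^ (k + 1)) q (n + 1) with hB
    have hAB : ∀ k, s n k = A k + B k := by
      intro k
      simp only [hs, hA, hB]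
      have e1 : qPoch (z ^ 2 * q ^ k) q (n + 1)
          = (1 - z ^ 2 * q ^ k) * qPoch (z ^ 2 * q ^ (k + 1)) q n := by
        rw [qPoch_succ', mul_assoc (z ^ 2), ← pow_succ]
      have e2 : qPoch (z ^ 2 * q ^ k) q (n + 2) = (1 - z ^ 2 * q ^ k)
          * (qPoch (z ^ 2 * q ^ (k + 1)) q n * (1 - z ^ 2 * q ^ (k + n + 1))) := by
        rw [qPoch_succ', mul_assoc, ← pow_succ, qPoch_succ]
        ring
      have e3 : qPoch (z ^ 2 * q ^ (k + 1)) q (n + 1)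
          = qPoch (z ^ 2 * q ^ (k + 1)) q n * (1 - z ^ 2 * q ^ (k + n + 1)) := by
        rw [qPoch_succ]
        ring
      rw [e1, e2, e3]
      have h1 := hD1 k
      have h2 := hD1 (k + n + 1)
      have h3 := hD (k + 1) n
      field_simp
      ring
    have h0 : s (n + 1) 0 = A 0 := by
      simp only [hs, hA, pow_zero, mul_one]
      rw [qPoch_succ z q (n + 1), zero_add]
      have h3 := hD 0 (n + 2)
      rw [pow_zero, mul_one] at h3
      rw [show n + 1 + 1 = n + 2 from rfl]
      field_simp
    have hstep : ∀ k ≤ n, qBinom q (n + 1 : ℕ) (k + 1 : ℕ) * s (n + 1) (k + 1)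
        = qBinom q n (k + 1 : ℕ) * A (k + 1) + qBinom q n k * B k := by
      intro k hk
      obtain ⟨c, c1, c2, c3⟩ := qBinom_common hq hk
      rw [c1, c2, c3]
      obtain ⟨d, rfl⟩ := Nat.exists_eq_add_of_le hk
      rw [Nat.add_sub_cancel_left]
      simp only [hs, hA, hB]
      have e1 : qPoch (z ^ 2 * q ^ (k + 1)) q (k + d + 2)
          = qPoch (z ^ 2 * q ^ (k + 1)) q (k + d + 1) * (1 - z ^ 2 * q ^ (k + 1 + (k + d + 1))) := by
        rw [qPoch_succ]
        ring
      rw [show k + d + 1 + 1 = k + d + 2 from rfl, e1, qPoch_succ z q (k + d + 1)]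
      have h1 := hD1 (k + 1 + (k + d + 1))
      have h3 := hD (k + 1) (k + d + 1)
      field_simp
      ring
    change ∑ k ∈ Finset.range (n + 2), qBinom q (n + 1 : ℕ) k * s (n + 1) k = 1
    rw [Finset.sum_range_succ']
    rw [Finset.sum_congr rfl fun k hk => hstep k (Nat.lt_succ_iff.1 (Finset.mem_range.1 hk))]
    rw [h0, Nat.cast_zero, qBinom_natCast_zero hq, one_mul, Finset.sum_add_distrib, add_right_comm]
    have hA' := Finset.sum_range_succ' (fun k : ℕ => qBinom q n k * A k) (n + 1)
    rw [Finset.sum_range_succ, qBinom_of_lt q (by push_cast; omega), Nat.cast_zero,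
      qBinom_natCast_zero hq, zero_mul, add_zero, one_mul] at hA'
    rw [← hA', ← Finset.sum_add_distrib, ← ih]
    refine Finset.sum_congr rfl fun k _ => ?_
    rw [← mul_add, ← hAB]

/-- The first s factors are reversed by 1 - w q^{-i} = -w q^{-i}(1 - q^i/w), 1 ≤ i ≤ s. -/
theorem qPoch_mul_zpow_neg (hq0 : q ≠ 0) {w : K} (hw : w ≠ 0) (s r : ℕ) :
    qPoch (w * q ^ (-(s : ℤ))) q (s + r)
      = (-1) ^ s * w ^ s * q ^ (-(triangular (s + 1) : ℤ)) * qPoch (q / w) q s * qPoch w q r := by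
  induction s with
  | zero => simp [qPoch_zero, triangular]
  | succ s ih =>
    have e1 : w * q ^ (-((s + 1 : ℕ) : ℤ)) * q = w * q ^ (-(s : ℤ)) := by
      rw [mul_assoc, ← zpow_add_one₀ hq0]
      push_cast
      ring_nf
    have e2 : -(triangular (((s + 1 : ℕ) : ℤ) + 1) : ℤ)
        = -(triangular ((s : ℤ) + 1) : ℤ) - ((s : ℤ) + 1) := by
      have h1 := two_mul_triangular (((s + 1 : ℕ) : ℤ) + 1)
      have h2 := two_mul_triangular ((s : ℤ) + 1)
      push_cast at h1 ⊢
      linarith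
    have e3 : q ^ ((s : ℤ) + 1) = q ^ (s + 1) := by
      rw [← zpow_natCast]
      norm_cast
    rw [show s + 1 + r = s + r + 1 by ring, qPoch_succ', e1, ih, e2, qPoch_succ (q / w),
      zpow_sub₀ hq0, zpow_neg q ((s + 1 : ℕ) : ℤ), Nat.cast_succ, e3]
    field_simp
    ring

/-- The previous sum with n = 2m and z replaced by z q^{-m}: this centres it at k = m, so that it
becomes bilateral as m → ∞. -/
theorem finite_quintuple_product_shifted (hq : ∀ m : ℕ, 1 ≤ m → q ^ m ≠ 1) (hq0 : q ≠ 0)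
    (hz0 : z ≠ 0) (hz : ∀ i : ℤ, z ^ 2 * q ^ i ≠ 1) (m : ℕ) :
    ∑ k ∈ Finset.range (2 * m + 1), qBinom q (2 * m : ℕ) k
      * ((-1) ^ ((k : ℤ) - m) * (1 + z * q ^ ((k : ℤ) - m)) * z ^ (3 * ((k : ℤ) - m))
        * q ^ ((triangular ((k : ℤ) - m) : ℤ) + ((k : ℤ) - m) ^ 2))
      / (qPoch (q / z ^ 2) q (2 * m - k) * qPoch (z ^ 2) q (k + 1))
      = 1 / (qPoch (q / z) q m * qPoch z q (m + 1)) := by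
  have hz' : ∀ i : ℕ, (z * q ^ (-(m : ℤ))) ^ 2 * q ^ i ≠ 1 := by
    intro i
    have := hz (-(m : ℤ) + -(m : ℤ) + i)
    rwa [zpow_add₀ hq0, zpow_add₀ hq0, zpow_natCast, ← mul_assoc, ← sq, ← mul_pow] at this
  have hzz : ∀ i : ℤ, z * q ^ i ≠ 1 := by
    intro i h
    apply hz (i + i)
    rw [zpow_add₀ hq0, ← sq, ← mul_pow, h, one_pow]
  have hne1 : qPoch (q / z) q m ≠ 0 := qPoch_ne_zero_of_forall _ _ (fun i h => by
    apply hzz (-(i + 1 : ℕ))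
    rw [zpow_neg, zpow_natCast, pow_succ']
    field_simp at h ⊢
    exact h.symm) m
  have hne2 : qPoch z q (m + 1) ≠ 0 := qPoch_ne_zero_of_forall _ _ (fun i => by
    rw [← zpow_natCast q]
    exact hzz i) _
  have hne3 : ∀ s, qPoch (q / z ^ 2) q s ≠ 0 := qPoch_ne_zero_of_forall _ _ (fun i h => by
    apply hz (-(i + 1 : ℕ))
    rw [zpow_neg, zpow_natCast, mul_inv_eq_one₀ (pow_ne_zero _ hq0), pow_succ' q]
    field_simp at h
    exact h.symm)
  have hne4 : ∀ s, qPoch (z ^ 2) q s ≠ 0 := qPoch_ne_zero_of_forall _ _ (fun i => by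
    rw [← zpow_natCast q]
    exact hz i)
  rw [eq_div_iff (mul_ne_zero hne1 hne2), Finset.sum_mul]
  refine (Finset.sum_congr rfl fun k hk => ?_).trans (finite_quintuple_product hq hz' (2 * m))
  obtain ⟨s, hs⟩ := Nat.exists_eq_add_of_le (Nat.lt_succ_iff.1 (Finset.mem_range.1 hk))
  have hsk : 2 * m - k = s := by omega
  have f1 : z * q ^ (-(m : ℤ)) * q ^ k = z * q ^ ((k : ℤ) - m) := by
    rw [mul_assoc, ← zpow_natCast q k, ← zpow_add₀ hq0]
    ring_nf
  have f2 : (z * q ^ (-(m : ℤ))) ^ 2 * q ^ k = z ^ 2 * q ^ (-(s : ℤ)) := by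
    rw [mul_pow, mul_assoc, sq (q ^ (-(m : ℤ))), ← zpow_natCast q k, ← zpow_add₀ hq0,
      ← zpow_add₀ hq0, show -(m : ℤ) + -(m : ℤ) + k = -s by omega]
  rw [f1, f2, show qPoch (z * q ^ (-(m : ℤ))) q (2 * m + 1)
      = qPoch (z * q ^ (-(m : ℤ))) q (m + (m + 1)) by congr 1; ring,
    show qPoch (z ^ 2 * q ^ (-(s : ℤ))) q (2 * m + 1)
      = qPoch (z ^ 2 * q ^ (-(s : ℤ))) q (s + (k + 1)) by congr 1; omega,
    qPoch_mul_zpow_neg hq0 hz0, qPoch_mul_zpow_neg hq0 (pow_ne_zero 2 hz0), hsk]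
  -- The monomials are matched separately in sign, z and q, using s = 2m - k.
  have g1 : (-1 : K) ^ m = (-1) ^ ((k : ℤ) - m) * (-1) ^ s := by
    rw [← zpow_natCast _ m, ← zpow_natCast _ s, ← zpow_add₀ (by norm_num)]
    congr 1
    omega
  have g2 : z ^ m * z ^ k = z ^ (3 * ((k : ℤ) - m)) * (z ^ 2) ^ s := by
    rw [← pow_mul, ← zpow_natCast z m, ← zpow_natCast z k, ← zpow_natCast z (2 * s),
      ← zpow_add₀ hz0, ← zpow_add₀ hz0]
    congr 1
    omega
  have g3 : q ^ (-(triangular ((m : ℤ) + 1) : ℤ)) * ((q ^ (-(m : ℤ))) ^ k * q ^ (k ^ 2))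
      = q ^ ((triangular ((k : ℤ) - m) : ℤ) + ((k : ℤ) - m) ^ 2)
        * q ^ (-(triangular ((s : ℤ) + 1) : ℤ)) := by
    rw [← zpow_natCast _ k, ← zpow_natCast q (k ^ 2), ← zpow_mul, ← zpow_add₀ hq0,
      ← zpow_add₀ hq0, ← zpow_add₀ hq0]
    congr 1
    have h1 := two_mul_triangular ((m : ℤ) + 1)
    have h2 := two_mul_triangular ((s : ℤ) + 1)
    have h3 := two_mul_triangular ((k : ℤ) - m)
    have h4 : (s : ℤ) = 2 * m - k := by omega
    rw [h4] at h2
    rw [h4]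
    push_cast
    linarith
  have hn3 := hne3 s
  have hn4 := hne4 (k + 1)
  have hq1 : q ^ (-(triangular ((s : ℤ) + 1) : ℤ)) ≠ 0 := zpow_ne_zero _ hq0
  have hs1 : (-1 : K) ^ s ≠ 0 := pow_ne_zero _ (by norm_num)
  have hs2 : (z ^ 2) ^ s ≠ 0 := pow_ne_zero _ (pow_ne_zero _ hz0)
  have hmono : (-1 : K) ^ m * z ^ m * q ^ (-(triangular ((m : ℤ) + 1) : ℤ))
        * ((z * q ^ (-(m : ℤ))) ^ k * q ^ (k ^ 2))
      = ((-1) ^ ((k : ℤ) - m) * z ^ (3 * ((k : ℤ) - m))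
        * q ^ ((triangular ((k : ℤ) - m) : ℤ) + ((k : ℤ) - m) ^ 2))
        * ((-1) ^ s * (z ^ 2) ^ s * q ^ (-(triangular ((s : ℤ) + 1) : ℤ))) := by
    calc _ = (-1 : K) ^ m * (z ^ m * z ^ k) * (q ^ (-(triangular ((m : ℤ) + 1) : ℤ))
        * ((q ^ (-(m : ℤ))) ^ k * q ^ (k ^ 2))) := by rw [mul_pow]; ring
      _ = _ := by rw [g1, g2, g3]; ring
  rw [show ∀ a b c d e : K, a * ((-1) ^ ((k : ℤ) - m) * b * c * d) / e
      = a * b * ((-1) ^ ((k : ℤ) - m) * c * d) / e by intros; ring]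
  generalize (-1 : K) ^ ((k : ℤ) - m) * z ^ (3 * ((k : ℤ) - m))
        * q ^ ((triangular ((k : ℤ) - m) : ℤ) + ((k : ℤ) - m) ^ 2) = X at hmono ⊢
  have hden : (-1 : K) ^ s * (z ^ 2) ^ s * q ^ (-(triangular ((s : ℤ) + 1) : ℤ)) ≠ 0 :=
    mul_ne_zero (mul_ne_zero hs1 hs2) hq1
  generalize (-1 : K) ^ s * (z ^ 2) ^ s * q ^ (-(triangular ((s : ℤ) + 1) : ℤ)) = Y at hmono hden ⊢
  generalize (-1 : K) ^ m * z ^ m * q ^ (-(triangular ((m : ℤ) + 1) : ℤ)) = W at hmono ⊢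
  generalize (z * q ^ (-(m : ℤ))) ^ k * q ^ (k ^ 2) = V at hmono ⊢
  field_simp
  linear_combination (-(qBinom q (2 * m : ℕ) k * (1 + z * q ^ ((k : ℤ) - m)))) * hmono

end Quintuple

/-! ### Limits of bilateral sums; the quintuple product. -/

section Analytic

variable {q : ℂ}

theorem pow_ne_one_of_norm_lt_one (hq : ‖q‖ < 1) (m : ℕ) (hm : 1 ≤ m) : q ^ m ≠ 1 := by
  intro h
  have h1 := pow_lt_one₀ (norm_nonneg q) hq (by omega : m ≠ 0)
  rw [← norm_pow, h, norm_one] at h1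
  exact lt_irrefl _ h1

theorem mul_pow_ne_one_of_norm_lt_one {a : ℂ} (ha : ‖a‖ < 1) (hq : ‖q‖ < 1) (i : ℕ) :
    a * q ^ i ≠ 1 := by
  intro h
  have h1 : ‖a * q ^ i‖ < 1 := by
    rw [norm_mul, norm_pow]
    exact mul_lt_one_of_nonneg_of_lt_one_left (norm_nonneg a) ha
      (pow_le_one₀ (norm_nonneg q) hq.le)
  rw [h, norm_one] at h1
  exact lt_irrefl _ h1

theorem norm_pow_lt_one (hq : ‖q‖ < 1) {m : ℕ} (hm : m ≠ 0) : ‖q ^ m‖ < 1 := by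
  rw [norm_pow]
  exact pow_lt_one₀ (norm_nonneg q) hq hm

theorem qPochInf_ne_zero {a : ℂ} (hq : ‖q‖ < 1) (ha : ∀ i : ℕ, a * q ^ i ≠ 1) :
    qPochInf a q ≠ 0 := by
  have hs : Summable fun k : ℕ => ‖-(a * q ^ k)‖ := by
    have := (summable_geometric_of_lt_one (norm_nonneg q) hq).mul_left ‖a‖
    simpa [norm_mul, norm_pow] using this
  have := tprod_one_add_ne_zero_of_summable (f := fun k : ℕ => -(a * q ^ k))
    (fun i => by rw [← sub_eq_add_neg]; exact sub_ne_zero.2 (ha i).symm) hs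
  simpa [qPochInf, sub_eq_add_neg] using this

theorem qPochInf_zero_left (q : ℂ) : qPochInf 0 q = 1 := by
  simp [qPochInf]

theorem tendsto_qPoch_inv {a : ℂ} (hq : ‖q‖ < 1) (ha : ∀ i : ℕ, a * q ^ i ≠ 1) :
    Tendsto (fun n => (qPoch a q n)⁻¹) atTop (𝓝 (qPochInf a q)⁻¹) :=
  (tendsto_qPoch a q hq).inv₀ (qPochInf_ne_zero hq ha)

theorem exists_norm_le_of_tendsto {f : ℕ → ℂ} {l : ℂ} (h : Tendsto f atTop (𝓝 l)) :
    ∃ C : ℝ, 0 ≤ C ∧ ∀ n, ‖f n‖ ≤ C := by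
  obtain ⟨C, hC⟩ := (Metric.isBounded_range_of_tendsto f h).exists_norm_le
  exact ⟨C, (norm_nonneg _).trans (hC _ ⟨0, rfl⟩), fun n => hC _ ⟨n, rfl⟩⟩

theorem qPochInf_sq (a : ℂ) (hq : ‖q‖ < 1) :
    qPochInf (a ^ 2) (q ^ 2) = qPochInf a q * qPochInf (-a) q := by
  refine tendsto_nhds_unique (tendsto_qPoch _ _ (norm_pow_lt_one hq two_ne_zero)) ?_
  refine ((tendsto_qPoch a q hq).mul (tendsto_qPoch (-a) q hq)).congr fun n => ?_
  rw [qPoch, qPoch, qPoch, ← Finset.prod_mul_distrib]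
  exact Finset.prod_congr rfl fun k _ => by ring

theorem qPochInf_even_odd (a : ℂ) (hq : ‖q‖ < 1) :
    qPochInf a q = qPochInf a (q ^ 2) * qPochInf (a * q) (q ^ 2) := by
  have h2 := norm_pow_lt_one hq two_ne_zero
  refine tendsto_nhds_unique ((tendsto_qPoch a q hq).comp
    (tendsto_id.const_mul_atTop' (r := 2) (by norm_num))) ?_
  refine ((tendsto_qPoch a _ h2).mul (tendsto_qPoch (a * q) _ h2)).congr fun n => ?_
  simp only [Function.comp_apply, id]
  induction n with
  | zero => simp [qPoch_zero]
  | succ n ih =>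
    rw [show 2 * (n + 1) = 2 * n + 1 + 1 by ring, qPoch_succ, qPoch_succ, qPoch_succ, qPoch_succ,
      ← ih]
    ring

theorem qPochInf_eq_one_sub_mul (a : ℂ) (hq : ‖q‖ < 1) :
    qPochInf a q = (1 - a) * qPochInf (a * q) q := by
  refine tendsto_nhds_unique ((tendsto_add_atTop_iff_nat 1).2 (tendsto_qPoch a q hq)) ?_
  refine ((tendsto_qPoch (a * q) q hq).const_mul (1 - a)).congr fun n => ?_
  rw [qPoch_succ']

theorem tendsto_natCast_add_toNat (j : ℤ) :
    Tendsto (fun m : ℕ => ((m : ℤ) + j).toNat) atTop atTop := by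
  refine tendsto_atTop.2 fun b => ?_
  filter_upwards [eventually_ge_atTop (b + j.natAbs)] with m hm
  omega

theorem tendsto_qPochRecip (hq : ‖q‖ < 1) (j : ℤ) :
    Tendsto (fun m : ℕ => qPochRecip q (m + j)) atTop (𝓝 (qPochInf q q)⁻¹) := by
  refine ((tendsto_qPoch_inv hq (mul_pow_ne_one_of_norm_lt_one hq hq)).comp
    (tendsto_natCast_add_toNat j)).congr' ?_
  filter_upwards [eventually_ge_atTop j.natAbs] with m hm
  simp [qPochRecip, show 0 ≤ (m : ℤ) + j by omega]

theorem exists_norm_qPochRecip_le (hq : ‖q‖ < 1) :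
    ∃ C : ℝ, 0 ≤ C ∧ ∀ n : ℤ, ‖qPochRecip q n‖ ≤ C := by
  obtain ⟨C, hC0, hC⟩ := exists_norm_le_of_tendsto
    (tendsto_qPoch_inv hq (mul_pow_ne_one_of_norm_lt_one hq hq))
  refine ⟨C, hC0, fun n => ?_⟩
  unfold qPochRecip
  split_ifs
  · exact hC _
  · simpa using hC0

theorem norm_mul_le_mul {a b : ℂ} {C D : ℝ} (ha : ‖a‖ ≤ C) (hb : ‖b‖ ≤ D) : ‖a * b‖ ≤ C * D :=
  (norm_mul_le a b).trans (mul_le_mul ha hb (norm_nonneg _) ((norm_nonneg _).trans ha))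

/-- Passage to the limit in a bilateral sum weighted by `q`-binomial coefficients and reciprocals
of `q`-Pochhammer symbols. -/
theorem tendsto_sum_bilateral (hq : ‖q‖ < 1) {x y : ℂ} (hx : ∀ i : ℕ, x * q ^ i ≠ 1)
    (hy : ∀ i : ℕ, y * q ^ i ≠ 1) {u : ℤ → ℂ} (hu : Summable fun j => ‖u j‖) :
    Tendsto (fun m : ℕ => ∑ j ∈ Finset.Icc (-(m : ℤ)) m, u j *
        (qPoch q q (2 * m) * (qPochRecip q (m + j) * qPochRecip q (m - j))
          * ((qPoch x q (m - j).toNat)⁻¹ * (qPoch y q (m + (j + 1)).toNat)⁻¹)))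
      atTop (𝓝 (∑' j, u j * ((qPochInf q q)⁻¹ * ((qPochInf x q)⁻¹ * (qPochInf y q)⁻¹)))) := by
  obtain ⟨C1, h10, h1⟩ := exists_norm_le_of_tendsto (tendsto_qPoch q q hq)
  obtain ⟨C2, h20, h2⟩ := exists_norm_qPochRecip_le hq
  obtain ⟨C3, h30, h3⟩ := exists_norm_le_of_tendsto (tendsto_qPoch_inv hq hx)
  obtain ⟨C4, h40, h4⟩ := exists_norm_le_of_tendsto (tendsto_qPoch_inv hq hy)
  have hne := qPochInf_ne_zero hq (mul_pow_ne_one_of_norm_lt_one hq hq)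
  refine (tendsto_tsum_of_dominated_convergence
    (f := fun (m : ℕ) (j : ℤ) => u j *
        (qPoch q q (2 * m) * (qPochRecip q (m + j) * qPochRecip q (m - j))
          * ((qPoch x q (m - j).toNat)⁻¹ * (qPoch y q (m + (j + 1)).toNat)⁻¹)))
    (hu.mul_right (C1 * (C2 * C2) * (C3 * C4))) (fun j => ?_)
    (Eventually.of_forall fun m j => ?_)).congr fun m => ?_
  · refine Tendsto.const_mul _ ?_
    -- The limit of (q)_{2m}/((q)_{m+j}(q)_{m-j}), written factor by factor.
    have e : (qPochInf q q)⁻¹ = qPochInf q q * ((qPochInf q q)⁻¹ * (qPochInf q q)⁻¹) := by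
      field_simp
    rw [e]
    refine (((tendsto_qPoch q q hq).comp
      (tendsto_id.const_mul_atTop' (r := 2) (by norm_num))).mul
      ((tendsto_qPochRecip hq j).mul ?_)).mul (Tendsto.mul ?_ ?_)
    · simpa [sub_eq_add_neg] using tendsto_qPochRecip hq (-j)
    · simpa [sub_eq_add_neg, Function.comp_def] using
        (tendsto_qPoch_inv hq hx).comp (tendsto_natCast_add_toNat (-j))
    · exact (tendsto_qPoch_inv hq hy).comp (tendsto_natCast_add_toNat (j + 1))
  · exact norm_mul_le_mul le_rfl (norm_mul_le_mul
      (norm_mul_le_mul (h1 _) (norm_mul_le_mul (h2 _) (h2 _))) (norm_mul_le_mul (h3 _) (h4 _)))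
  · refine tsum_eq_sum fun j hj => ?_
    rw [Finset.mem_Icc] at hj
    rcases lt_or_ge ((m : ℤ) + j) 0 with h | h
    · rw [qPochRecip_of_neg q h]
      ring
    · rw [qPochRecip_of_neg q (m := (m : ℤ) - j) (by omega)]
      ring

theorem norm_legendreSym_three_le (j : ℤ) : ‖(legendreSym 3 j : ℂ)‖ ≤ 1 := by
  have h : j % 3 = 0 ∨ j % 3 = 1 ∨ j % 3 = 2 := by omega
  rcases h with h | h | h
  · simp [legendreSym_three_of_mod_zero h]
  · simp [legendreSym_three_of_mod_one h]
  · simp [legendreSym_three_of_mod_two h]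

theorem summable_norm_legendreTerm (hq : ‖q‖ < 1) {v : ℕ} (hv : 1 ≤ v) :
    Summable fun j : ℤ => ‖legendreTerm q v j‖ := by
  have hn : Summable fun n : ℕ => ‖q‖ ^ (n - 1) :=
    (summable_nat_add_iff 1).1 (by simpa using summable_geometric_of_lt_one (norm_nonneg q) hq)
  have hb : Summable fun j : ℤ => ‖q‖ ^ (j.natAbs - 1) := by
    refine Summable.of_nat_of_neg ?_ ?_
    · simpa using hn
    · simpa using hn
  refine hb.of_nonneg_of_le (fun _ => norm_nonneg _) fun j => ?_
  rw [legendreTerm_eq, norm_mul, norm_pow]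
  refine (mul_le_of_le_one_left (by positivity) (norm_legendreSym_three_le j)).trans
    (pow_le_pow_of_le_one (norm_nonneg q) hq.le ?_)
  -- The exponent dominates |j| - 1; v ≥ 1 enters here.
  have h1 : (j ^ 2 - 1).toNat ≤ v * (j ^ 2 - 1).toNat := Nat.le_mul_of_pos_left _ hv
  have h2 : j.natAbs - 1 ≤ (j ^ 2 - 1).toNat := by
    have : (j.natAbs : ℤ) ≤ j ^ 2 := Int.natAbs_le_self_sq j
    omega
  omega

theorem tendsto_bilateral (hq : ‖q‖ < 1) {v : ℕ} (hv : 1 ≤ v) :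
    Tendsto (fun L : ℕ => ∑ᶠ j : ℤ, legendreTerm q v j * qBinom q (2 * L) (L + j)) atTop
      (𝓝 ((∑' j, legendreTerm q v j) / qPochInf q q)) := by
  -- With x = y = 0 the two additional Pochhammer symbols are 1.
  have h := tendsto_sum_bilateral hq (x := 0) (y := 0) (by simp) (by simp)
    (summable_norm_legendreTerm hq hv)
  rw [tsum_mul_right] at h
  simp only [qPochInf_zero_left, inv_one, mul_one] at h
  rw [div_eq_mul_inv]
  refine h.congr fun L => ?_
  rw [finsum_legendreTerm_mul_qBinom, bilateralSum, Finset.mul_sum]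
  refine Finset.sum_congr rfl fun j _ => ?_
  simp only [qPoch, zero_mul, sub_zero, Finset.prod_const_one, inv_one, mul_one]
  ring

theorem sum_range_eq_sum_Icc {M : Type*} [AddCommMonoid M] (m : ℕ) (f : ℤ → M) :
    ∑ k ∈ Finset.range (2 * m + 1), f (k - m) = ∑ j ∈ Finset.Icc (-(m : ℤ)) m, f j := by
  refine Finset.sum_nbij' (fun k : ℕ => (k : ℤ) - m) (fun j : ℤ => (j + m).toNat) ?_ ?_ ?_ ?_ ?_
  · intro k hk
    simp only [Finset.mem_Icc, Finset.mem_range] at hk ⊢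
    omega
  · intro j hj
    simp only [Finset.mem_Icc, Finset.mem_range] at hj ⊢
    omega
  · intro k _
    omega
  · intro j hj
    simp only [Finset.mem_Icc] at hj
    omega
  · intro k _
    rfl

/-- The quintuple product identity. -/
theorem quintuple_product {z : ℂ} (hq : ‖q‖ < 1) (hq0 : q ≠ 0) (hz0 : z ≠ 0)
    (hz : ∀ i : ℤ, z ^ 2 * q ^ i ≠ 1) {u : ℤ → ℂ}
    (hu : ∀ j, u j = (-1) ^ j * (1 + z * q ^ j) * z ^ (3 * j) * q ^ ((triangular j : ℤ) + j ^ 2))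
    (hsum : Summable fun j => ‖u j‖) :
    (∑' j, u j) * (qPochInf (q / z) q * qPochInf z q)
      = qPochInf q q * (qPochInf (q / z ^ 2) q * qPochInf (z ^ 2) q) := by
  have hzz : ∀ i : ℤ, z * q ^ i ≠ 1 := by
    intro i h
    apply hz (i + i)
    rw [zpow_add₀ hq0, ← sq, ← mul_pow, h, one_pow]
  have hinv : ∀ w : ℂ, w ≠ 0 → (∀ i : ℤ, w * q ^ i ≠ 1) → ∀ i : ℕ, q / w * q ^ i ≠ 1 := by
    intro w hw0 hw i h
    apply hw (-(i + 1 : ℕ))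
    rw [zpow_neg, zpow_natCast, mul_inv_eq_one₀ (pow_ne_zero _ hq0), pow_succ' q]
    field_simp at h
    exact h.symm
  have hnat : ∀ w : ℂ, (∀ i : ℤ, w * q ^ i ≠ 1) → ∀ i : ℕ, w * q ^ i ≠ 1 := by
    intro w hw i
    rw [← zpow_natCast q]
    exact hw i
  have hx := hinv _ (pow_ne_zero 2 hz0) hz
  have hy := hnat _ hz
  have h1 := tendsto_sum_bilateral hq hx hy hsum
  have h2 : Tendsto (fun m : ℕ => (qPoch (q / z) q m)⁻¹ * (qPoch z q (m + 1))⁻¹) atTop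
      (𝓝 ((qPochInf (q / z) q)⁻¹ * (qPochInf z q)⁻¹)) :=
    (tendsto_qPoch_inv hq (hinv _ hz0 hzz)).mul
      ((tendsto_add_atTop_iff_nat 1).2 (tendsto_qPoch_inv hq (hnat _ hzz)))
  have h3 := tendsto_nhds_unique h1 (h2.congr fun m => ?_)
  · rw [tsum_mul_right] at h3
    have n1 := qPochInf_ne_zero hq hx
    have n2 := qPochInf_ne_zero hq hy
    have n3 := qPochInf_ne_zero hq (mul_pow_ne_one_of_norm_lt_one hq hq)
    have n4 := qPochInf_ne_zero hq (hinv _ hz0 hzz)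
    have n5 := qPochInf_ne_zero hq (hnat _ hzz)
    field_simp at h3
    linear_combination h3
  · have := finite_quintuple_product_shifted (pow_ne_one_of_norm_lt_one hq) hq0 hz0 hz m
    rw [← sum_range_eq_sum_Icc, ← mul_inv, ← one_div, ← this]
    refine Finset.sum_congr rfl fun k hk => ?_
    have hk := Finset.mem_range.1 hk
    rw [← hu, qBinom_eq_recip, show ((m : ℤ) - (k - m)).toNat = 2 * m - k by omega,
      show ((m : ℤ) + (k - m + 1)).toNat = k + 1 by omega,
      show (m : ℤ) + (k - m) = k by ring,
      show ((2 * m : ℕ) : ℤ) - k = m - (k - m) by push_cast; ring, div_eq_mul_inv, mul_inv]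
    ring

end Analytic

/-! ### Evaluation of the limit and convergence of the multisum. -/

section Limit

variable {q : ℂ}

theorem tsum_int_mod_three {f : ℤ → ℂ} (hf : Summable f) :
    ∑' j, f j = ∑' k : ℤ, (f (3 * k) + f (3 * k + 1) + f (3 * k + 2)) := by
  have hf' : Summable fun p : ℤ × Fin 3 => f ((Int.divModEquiv 3).symm p) :=
    (Int.divModEquiv 3).symm.summable_iff.2 hf
  rw [← (Int.divModEquiv 3).symm.tsum_eq, hf'.tsum_prod]
  refine tsum_congr fun k => ?_
  rw [tsum_fintype, Fin.sum_univ_three]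
  simp only [Int.divModEquiv_symm_apply]
  simp [mul_comm]

theorem tsum_legendreTerm_eq (hq : ‖q‖ < 1) {v : ℕ} (hv : 1 ≤ v) :
    ∑' j, legendreTerm q v j
      = ∑' k : ℤ, (legendreTerm q v (3 * k + 1) + legendreTerm q v (3 * k + 2)) := by
  rw [tsum_int_mod_three (summable_norm_legendreTerm hq hv).of_norm]
  refine tsum_congr fun k => ?_
  have h0 : legendreTerm q v (3 * k) = 0 := by
    rw [legendreTerm, legendreSym_three_of_mod_zero (by omega), Int.cast_zero, zero_mul]
  rw [h0, zero_add]

theorem summable_norm_legendreTerm_pair (hq : ‖q‖ < 1) {v : ℕ} (hv : 1 ≤ v) :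
    Summable fun k : ℤ => ‖legendreTerm q v (3 * k + 1) + legendreTerm q v (3 * k + 2)‖ := by
  have hs := summable_norm_legendreTerm hq hv
  have h1 := hs.comp_injective (i := fun k : ℤ => 3 * k + 1) (fun a b h => by simpa using h)
  have h2 := hs.comp_injective (i := fun k : ℤ => 3 * k + 2) (fun a b h => by simpa using h)
  exact (h1.add h2).of_nonneg_of_le (fun _ => norm_nonneg _) fun k => norm_add_le _ _

/-- The quintuple summand with base Q = q^{6v+3} and z = -q^{3v}: the exponent at 3k + 2 exceeds
that at 3k + 1 by 3v + (6v+3)k, and the symbols 1, -1 give the factor 1 + zQ^k. -/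
theorem legendreTerm_pair_eq (hq0 : q ≠ 0) (v : ℕ) (k : ℤ) :
    legendreTerm q v (3 * k + 1) + legendreTerm q v (3 * k + 2)
      = (-1) ^ k * (1 + -q ^ (3 * v) * (q ^ (6 * v + 3)) ^ k) * (-q ^ (3 * v)) ^ (3 * k)
        * (q ^ (6 * v + 3)) ^ ((triangular k : ℤ) + k ^ 2) := by
  have ht := two_mul_triangular k
  set t : ℤ := (triangular k : ℤ)
  have e1 : ((2 * (v : ℤ) + 1) * (3 * k + 1) ^ 2 - 3 * (3 * k + 1)) / 2 - ((v : ℤ) - 1)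
      = 9 * v * k + (6 * v + 3) * (t + k ^ 2) := by
    have : (2 * (v : ℤ) + 1) * (3 * k + 1) ^ 2 - 3 * (3 * k + 1)
        = 2 * (9 * v * k + (6 * v + 3) * (t + k ^ 2) + (v - 1)) := by
      linear_combination (-(6 * (v : ℤ) + 3)) * ht
    rw [this, Int.mul_ediv_cancel_left _ (by norm_num)]
    ring
  have e2 : ((2 * (v : ℤ) + 1) * (3 * k + 2) ^ 2 - 3 * (3 * k + 2)) / 2 - ((v : ℤ) - 1)
      = 9 * v * k + (6 * v + 3) * (t + k ^ 2) + (3 * v + (6 * v + 3) * k) := by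
    have : (2 * (v : ℤ) + 1) * (3 * k + 2) ^ 2 - 3 * (3 * k + 2)
        = 2 * (9 * v * k + (6 * v + 3) * (t + k ^ 2) + (3 * v + (6 * v + 3) * k) + (v - 1)) := by
      linear_combination (-(6 * (v : ℤ) + 3)) * ht
    rw [this, Int.mul_ediv_cancel_left _ (by norm_num)]
    ring
  have hsign : (-1 : ℂ) ^ k * (-q ^ (3 * v)) ^ (3 * k) = q ^ (9 * v * k) := by
    have h1 : (-1 : ℂ) ^ k * (-1) ^ (3 * k) = 1 := by
      rw [← zpow_add₀ (by norm_num), show k + 3 * k = 2 * (2 * k) by ring, zpow_mul]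
      norm_num
    have h2 : (q ^ (3 * v)) ^ (3 * k) = q ^ (9 * v * k) := by
      rw [← zpow_natCast q, ← zpow_mul]
      congr 1
      push_cast
      ring
    rw [neg_eq_neg_one_mul (q ^ (3 * v)), mul_zpow, ← mul_assoc, h1, h2, one_mul]
  have hQ : ∀ i : ℤ, (q ^ (6 * v + 3)) ^ i = q ^ ((6 * v + 3) * i) := by
    intro i
    rw [← zpow_natCast q, ← zpow_mul]
    push_cast
    rfl
  have h3 : q ^ (3 * v) = q ^ (3 * (v : ℤ)) := by
    rw [← zpow_natCast q]
    push_cast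
    rfl
  rw [legendreTerm, legendreTerm, e1, e2, legendreSym_three_of_mod_one (by omega),
    legendreSym_three_of_mod_two (by omega), mul_right_comm ((-1 : ℂ) ^ k), hsign, hQ, hQ, h3,
    zpow_add₀ hq0 (9 * v * k + _), zpow_add₀ hq0 (9 * v * k), zpow_add₀ hq0 (3 * v)]
  push_cast
  ring

theorem tsum_legendreTerm_mul (hq : ‖q‖ < 1) (hq0 : q ≠ 0) {v : ℕ} (hv : 1 ≤ v) :
    (∑' j, legendreTerm q v j)
        * (qPochInf (-q ^ (3 * v + 3)) (q ^ (6 * v + 3)) * qPochInf (-q ^ (3 * v)) (q ^ (6 * v + 3)))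
      = qPochInf (q ^ (6 * v + 3)) (q ^ (6 * v + 3))
        * (qPochInf (q ^ 3) (q ^ (6 * v + 3)) * qPochInf (q ^ (6 * v)) (q ^ (6 * v + 3))) := by
  have hQ := norm_pow_lt_one hq (show 6 * v + 3 ≠ 0 by omega)
  have hz : ∀ i : ℤ, (-q ^ (3 * v)) ^ 2 * (q ^ (6 * v + 3)) ^ i ≠ 1 := by
    intro i h
    have h1 : q ^ (6 * (v : ℤ) + (6 * v + 3) * i) = 1 := by
      rw [neg_sq, ← pow_mul, ← zpow_natCast q, ← zpow_natCast q, ← zpow_mul, ← zpow_add₀ hq0] at h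
      rw [← h]
      push_cast
      congr 1
      ring
    -- 6v is not a multiple of 6v + 3, since 0 < 6v < 6v + 3.
    have h2 : 6 * (v : ℤ) + (6 * v + 3) * i ≠ 0 := by
      intro h0
      have hv' : (1 : ℤ) ≤ v := by exact_mod_cast hv
      rcases lt_or_ge i 0 with hi | hi
      · nlinarith
      · nlinarith
    have h3 : ‖q‖ ^ (6 * (v : ℤ) + (6 * v + 3) * i) = 1 := by rw [← norm_zpow, h1, norm_one]
    exact h2 ((zpow_eq_one_iff_right₀ (norm_nonneg q) hq.ne).1 h3)
  have h := quintuple_product hQ (pow_ne_zero _ hq0) (neg_ne_zero.2 (pow_ne_zero (3 * v) hq0)) hz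
    (legendreTerm_pair_eq hq0 v) (summable_norm_legendreTerm_pair hq hv)
  have d1 : q ^ (6 * v + 3) / -q ^ (3 * v) = -q ^ (3 * v + 3) := by
    rw [div_eq_iff (neg_ne_zero.2 (pow_ne_zero _ hq0))]
    ring
  have d2 : (-q ^ (3 * v)) ^ 2 = q ^ (6 * v) := by
    rw [neg_sq, ← pow_mul]
    ring_nf
  have d3 : q ^ (6 * v + 3) / q ^ (6 * v) = q ^ 3 := by
    rw [div_eq_iff (pow_ne_zero _ hq0)]
    ring
  rwa [d2, d1, d3, ← tsum_legendreTerm_eq hq hv] at h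

theorem one_sub_pow_ne_zero (hq : ‖q‖ < 1) {m : ℕ} (hm : 1 ≤ m) : 1 - q ^ m ≠ 0 :=
  sub_ne_zero.2 (pow_ne_one_of_norm_lt_one hq m hm).symm

/-- With Q = q^{6v+3}, split (q^{6v};Q)_∞ and (q³;Q)_∞ into even and odd factors, then use (a²;Q²)_∞
= (a;Q)_∞(-a;Q)_∞ for a = q^{3v}, q^{3v+3}. The products in -a cancel, and 1 - q³ and 1 - q cancel
against the prefactor. -/
theorem productSide_eq_of_ne_zero (hq : ‖q‖ < 1) (hq0 : q ≠ 0) {v : ℕ} (hv : 1 ≤ v) :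
    (1 - q) / (1 - q ^ 3) * ((∑' j, legendreTerm q v j) / qPochInf q q) = productSide q v := by
  have h := tsum_legendreTerm_mul hq hq0 hv
  have hQ := norm_pow_lt_one hq (show 6 * v + 3 ≠ 0 by omega)
  have hQ2 := norm_pow_lt_one hq (show 12 * v + 6 ≠ 0 by omega)
  have n0 := norm_pow_lt_one hq (show 3 * v ≠ 0 by omega)
  have n1 := norm_pow_lt_one hq (show 3 * v + 3 ≠ 0 by omega)
  have s1 := qPochInf_sq (q ^ (3 * v)) hQ
  have s2 := qPochInf_sq (q ^ (3 * v + 3)) hQ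
  have t1 := qPochInf_even_odd (q ^ (6 * v)) hQ
  have t2 := qPochInf_even_odd (q ^ 3) hQ
  have t3 := qPochInf_eq_one_sub_mul (q ^ 3) hQ2
  have t4 := qPochInf_eq_one_sub_mul q hq
  rw [show (q ^ (3 * v)) ^ 2 = q ^ (6 * v) by ring,
    show (q ^ (6 * v + 3)) ^ 2 = q ^ (12 * v + 6) by ring] at s1
  rw [show (q ^ (3 * v + 3)) ^ 2 = q ^ (6 * v + 6) by ring,
    show (q ^ (6 * v + 3)) ^ 2 = q ^ (12 * v + 6) by ring] at s2
  rw [show (q ^ (6 * v + 3)) ^ 2 = q ^ (12 * v + 6) by ring,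
    show q ^ (6 * v) * q ^ (6 * v + 3) = q ^ (12 * v + 3) by ring] at t1
  rw [show (q ^ (6 * v + 3)) ^ 2 = q ^ (12 * v + 6) by ring,
    show q ^ 3 * q ^ (6 * v + 3) = q ^ (6 * v + 6) by ring] at t2
  rw [show q ^ 3 * q ^ (12 * v + 6) = q ^ (12 * v + 9) by ring] at t3
  rw [show q * q = q ^ 2 by ring] at t4
  have m1 : qPochInf (-q ^ (3 * v)) (q ^ (6 * v + 3)) ≠ 0 :=
    qPochInf_ne_zero hQ (mul_pow_ne_one_of_norm_lt_one (by rwa [norm_neg]) hQ)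
  have m2 : qPochInf (-q ^ (3 * v + 3)) (q ^ (6 * v + 3)) ≠ 0 :=
    qPochInf_ne_zero hQ (mul_pow_ne_one_of_norm_lt_one (by rwa [norm_neg]) hQ)
  have m3 : qPochInf (q ^ 2) q ≠ 0 :=
    qPochInf_ne_zero hq (mul_pow_ne_one_of_norm_lt_one (norm_pow_lt_one hq two_ne_zero) hq)
  have m4 : 1 - q ≠ 0 := by simpa using one_sub_pow_ne_zero hq le_rfl
  have m5 := one_sub_pow_ne_zero hq (show 1 ≤ 3 by norm_num)
  rw [t2, t3, s2, t1, s1] at h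
  have hS : ∑' j, legendreTerm q v j = qPochInf (q ^ (6 * v + 3)) (q ^ (6 * v + 3))
      * ((1 - q ^ 3) * qPochInf (q ^ (12 * v + 9)) (q ^ (12 * v + 6))
        * qPochInf (q ^ (3 * v + 3)) (q ^ (6 * v + 3))
        * (qPochInf (q ^ (3 * v)) (q ^ (6 * v + 3))
          * qPochInf (q ^ (12 * v + 3)) (q ^ (12 * v + 6)))) := by
    apply mul_right_cancel₀ (mul_ne_zero m2 m1)
    rw [h]
    ring
  rw [hS, t4, productSide]
  field_simp

theorem tsum_legendreTerm_zero_base {v : ℕ} (hv : 1 ≤ v) : ∑' j, legendreTerm (0 : ℂ) v j = 1 := by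
  rw [tsum_eq_single 1]
  · rw [legendreTerm_eq, legendreSym_three_of_mod_one (by norm_num)]
    simp [triangular]
  · intro j hj
    rcases eq_or_ne j 0 with rfl | h0
    · exact legendreTerm_zero_right _ _
    · rw [legendreTerm_eq, zero_pow, mul_zero]
      have ht := two_mul_triangular (j - 1)
      -- Away from j = 1 the triangular part is positive except at j = 2, where v(j² - 1) = 3v takes
      -- over.
      have h2 : 0 < (j - 1 - 1) * (j - 1) ∨ j = 2 := by
        rcases lt_or_ge j 1 with h | h
        · left; nlinarith
        · rcases eq_or_ne j 2 with h' | h'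
          · exact Or.inr h'
          · left
            have : 3 ≤ j := by omega
            nlinarith
      rcases h2 with h2 | rfl
      · have : 0 < triangular (j - 1) := by
          zify
          linarith
        omega
      · norm_num
        omega

theorem productSide_zero_base {v : ℕ} (hv : 1 ≤ v) : productSide 0 v = 1 := by
  have : v ≠ 0 := by omega
  simp [productSide, qPochInf_zero_left, this]

theorem productSide_eq (hq : ‖q‖ < 1) {v : ℕ} (hv : 1 ≤ v) :
    (1 - q) / (1 - q ^ 3) * ((∑' j, legendreTerm q v j) / qPochInf q q) = productSide q v := by
  rcases eq_or_ne q 0 with rfl | hq0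
  · rw [tsum_legendreTerm_zero_base hv, productSide_zero_base hv, qPochInf_zero_left]
    norm_num
  · exact productSide_eq_of_ne_zero hq hq0 hv

theorem exists_norm_innerTerm_le (hq : ‖q‖ < 1) :
    ∃ C : ℝ, 0 ≤ C ∧ ∀ n, ‖innerTerm q n‖ ≤ C := by
  have hq1 := pow_ne_one_of_norm_lt_one hq
  obtain ⟨C1, h10, h1⟩ := exists_norm_le_of_tendsto
    (tendsto_qPoch_inv hq (mul_pow_ne_one_of_norm_lt_one hq hq))
  obtain ⟨C2, h20, h2⟩ := exists_norm_le_of_tendsto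
    (tendsto_qPoch (-1) (q ^ 3) (norm_pow_lt_one hq (by norm_num)))
  obtain ⟨C3, h30, h3⟩ := exists_norm_le_of_tendsto (tendsto_qPoch_inv (a := -1) hq (fun i h => by
    apply one_add_pow_ne_zero hq1 i
    linear_combination -h))
  refine ⟨1 * 2 * C1 * (C2 * C3), by positivity, fun n => ?_⟩
  have hp : ∀ m, ‖q ^ m‖ ≤ 1 := fun m => by
    rw [norm_pow]
    exact pow_le_one₀ (norm_nonneg q) hq.le
  rw [innerTerm, div_eq_mul_inv, div_eq_mul_inv]
  refine norm_mul_le_mul (norm_mul_le_mul (norm_mul_le_mul (hp n) ?_) (h1 _))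
    (norm_mul_le_mul (h2 _) (h3 _))
  refine (norm_sub_le _ _).trans ?_
  rw [norm_one]
  linarith [hp (1 + n)]

/-- Since (N_1 + 2)N_1 ≥ n_1, prepending an index a costs at most a constant times |q|^a. -/
theorem summable_norm_multisumTerm (hq : ‖q‖ < 1) (v : ℕ) :
    Summable fun n => ‖multisumTerm q (v + 1) (Nat.le_add_left _ _) n‖ := by
  have hgeom := summable_geometric_of_lt_one (norm_nonneg q) hq
  induction v with
  | zero =>
    obtain ⟨C, hC0, hC⟩ := exists_norm_innerTerm_le hq
    have hs : Summable fun n : Fin 1 → ℕ => ‖q‖ ^ n 0 * C :=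
      (Equiv.funUnique (Fin 1) ℕ).summable_iff.2 (hgeom.mul_right C)
    refine hs.of_nonneg_of_le (fun _ => norm_nonneg _) fun n => ?_
    have hone : multisumTerm q (0 + 1) (Nat.le_add_left _ _) n
      = q ^ ((n 0 + 2) * n 0) * innerTerm q (n 0) := multisumTerm_one q n
    rw [hone]
    refine norm_mul_le_mul ?_ (hC _)
    rw [norm_pow]
    exact pow_le_pow_of_le_one (norm_nonneg q) hq.le (Nat.le_mul_of_pos_left _ (by omega))
  | succ v ih =>
    obtain ⟨C, hC0, hC⟩ := exists_norm_le_of_tendsto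
      (tendsto_qPoch_inv hq (mul_pow_ne_one_of_norm_lt_one hq hq))
    have hs := Summable.mul_of_nonneg (hgeom.mul_right C) ih
      (fun a => mul_nonneg (pow_nonneg (norm_nonneg q) a) hC0) (fun _ => norm_nonneg _)
    rw [← (Fin.consEquiv fun _ : Fin (v + 2) => ℕ).summable_iff]
    refine hs.of_nonneg_of_le (fun _ => norm_nonneg _) fun p => ?_
    change ‖multisumTerm q (v + 2) _ (Fin.cons p.1 p.2)‖ ≤ _
    rw [multisumTerm_cons]
    refine norm_mul_le_mul (norm_mul_le_mul ?_ (hC _)) le_rfl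
    rw [norm_pow]
    refine pow_le_pow_of_le_one (norm_nonneg q) hq.le ?_
    exact (Nat.le_add_right _ _).trans (Nat.le_mul_of_pos_left _ (by omega))

/-- For fixed n, (q)_{2L}/(q)_{L-1-N_1} tends to 1, and it is bounded uniformly in L and n. -/
theorem tendsto_multisum (hq : ‖q‖ < 1) (v : ℕ) :
    Tendsto (fun L : ℕ => ∑ᶠ n, finiteMultisumTerm q (v + 1) (Nat.le_add_left _ _) L n) atTop
      (𝓝 (∑' n, multisumTerm q (v + 1) (Nat.le_add_left _ _) n)) := by
  obtain ⟨C1, h10, h1⟩ := exists_norm_le_of_tendsto (tendsto_qPoch q q hq)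
  obtain ⟨C2, h20, h2⟩ := exists_norm_qPochRecip_le hq
  have hne := qPochInf_ne_zero hq (mul_pow_ne_one_of_norm_lt_one hq hq)
  refine (tendsto_tsum_of_dominated_convergence
    (f := fun (L : ℕ) n => finiteMultisumTerm q (v + 1) (Nat.le_add_left _ _) L n)
    ((summable_norm_multisumTerm hq v).mul_right (C1 * C2)) (fun n => ?_)
    (Eventually.of_forall fun L n => ?_)).congr fun L => ?_
  · have h := ((tendsto_qPoch q q hq).comp
      (tendsto_id.const_mul_atTop' (r := 2) (by norm_num))).mul (tendsto_qPochRecip hq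
        (-1 - tailSum n (firstIdx (v + 1) (Nat.le_add_left _ _))))
    rw [mul_inv_cancel₀ hne] at h
    have h' := h.const_mul (multisumTerm q (v + 1) (Nat.le_add_left _ _) n)
    rw [mul_one] at h'
    refine h'.congr fun L => ?_
    rw [finiteMultisumTerm, add_sub, ← sub_eq_add_neg]
    rfl
  · exact norm_mul_le_mul le_rfl (norm_mul_le_mul (h1 _) (h2 _))
  · rw [finsum_eq_sum_of_support_subset _ (support_finiteMultisumTerm_subset q v L)]
    exact tsum_eq_sum fun n hn => by
      by_contra h
      exact hn (support_finiteMultisumTerm_subset q v L h)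

end Limit

end

theorem mainTheorem7 (v : ℕ) (hv : 1 ≤ v) :
    (∀ (K : Type*) [Field K] [CharZero K] (q : K), (∀ m : ℕ, 1 ≤ m → q ^ m ≠ 1) → ∀ L : ℕ,
      (Function.support (finiteMultisumTerm q v hv L)).Finite ∧
      (Function.support fun j : ℤ => legendreTerm q v j * qBinom q (2 * L) (L + j)).Finite ∧
      (1 - q ^ 3) / (1 - q) * ∑ᶠ n : Fin v → ℕ, finiteMultisumTerm q v hv L n
        = ∑ᶠ j : ℤ, legendreTerm q v j * qBinom q (2 * L) (L + j)) ∧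
    (∀ q : ℂ, ‖q‖ < 1 →
      Tendsto (fun L : ℕ => (1 - q) / (1 - q ^ 3)
          * ∑ᶠ j : ℤ, legendreTerm q v j * qBinom q (2 * L) (L + j))
        atTop (𝓝 (productSide q v)) ∧
      HasSum (fun n : Fin v → ℕ => multisumTerm q v hv n) (productSide q v) ∧
      HasSum (fun j : ℤ => (1 - q) / (1 - q ^ 3) * (legendreTerm q v j / qPochInf q q))
        (productSide q v)) := by
  obtain ⟨v, rfl⟩ : ∃ w, v = w + 1 := ⟨v - 1, by omega⟩
  refine ⟨fun K _ _ q hq L => ⟨?_, ?_, finite_identity hq v L⟩, fun q hq => ?_⟩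
  · exact (Finset.finite_toSet _).subset (support_finiteMultisumTerm_subset q v L)
  · exact (Finset.finite_toSet _).subset (support_legendreTerm_mul_qBinom_subset q (v + 1) L)
  · have hlim := (tendsto_bilateral hq hv).const_mul ((1 - q) / (1 - q ^ 3))
    rw [productSide_eq hq hv] at hlim
    refine ⟨hlim, ?_, ?_⟩
    -- Both sides are limits of the two sides of the finite identity.
    · have hmulti : ∑' n, multisumTerm q (v + 1) hv n = productSide q (v + 1) := by
        refine tendsto_nhds_unique (tendsto_multisum hq v) (hlim.congr fun L => ?_)
        have m4 : 1 - q ≠ 0 := by simpa using one_sub_pow_ne_zero hq le_rfl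
        have m5 := one_sub_pow_ne_zero hq (show 1 ≤ 3 by norm_num)
        rw [← finite_identity (pow_ne_one_of_norm_lt_one hq) v L]
        field_simp
      rw [← hmulti]
      exact (summable_norm_multisumTerm hq v).of_norm.hasSum
    · rw [← productSide_eq hq hv]
      exact ((summable_norm_legendreTerm hq hv).of_norm.hasSum.div_const _).mul_left _
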